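/- Let $d\in\mathbb N$ (so $d\ge 1$), $0<p\le u<\infty$, $0<q\le\infty$ and $s\in\mathbb R$. The Morrey quasi-norm of a measurable function $g$ on $\mathbb R^d$ is $$\|g\,|\,\mathcal M^u_p\| := \sup_{y\in\mathbb R^d,\,R>0} |B(y,R)|^{\frac1u-\frac1p}\Big(\int_{B(y,R)}|g(x)|^p\,dx\Big)^{1/p}\in[0,\infty].$$ Fix $1\le a<b\le 2$ and a non-negative $\varphi_0\in C_c^\infty(\mathbb R^d)$ with $\varphi_0(x)=1$ for $|x|\le a$ and $\varphi_0(x)=0$ for $|x|\ge b$. For $\lambda>0$ put $D_\lambda g:=g(\lambda\,\cdot)$, and let $\psi:=\varphi_0-D_2\varphi_0$, $\psi_k:=D_{2^{-k}}\psi$ for $k\in\mathbb Z$, and $\varphi_k:=\psi_k$ for integers $k\ge1$. Let $\mathcal F$ be the Fourier transform on $\mathcal S'(\mathbb R^d)$, normalized by $\mathcal F f(\xi)=\int f(x)\,e^{-2\pi i x\cdot\xi}\,dx$. For $\eta\in C_c^\infty(\mathbb R^d)$ and $f\in\mathcal S'(\mathbb R^d)$ the distribution $\mathcal F^{-1}[\eta\,\mathcal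 F f]$ is identified with the smooth function inducing it. For $f\in\mathcal S'(\mathbb R^d)$ define, with values in $[0,\infty]$ (and with the sum over $k$ replaced by the supremum of $2^{ks}|\cdot|$ if $q=\infty$), $$\|f\,|\,\mathcal E^s_{u,p,q}\| := \Big\|\Big(\sum_{k=0}^\infty 2^{ksq}\,\big|\mathcal F^{-1}[\varphi_k\,\mathcal F f](\cdot)\big|^q\Big)^{1/q}\,\Big|\,\mathcal M^u_p\Big\|,$$ $$|f|_K := \Big\|\Big(\sum_{k=-K}^\infty 2^{ksq}\,\big|\mathcal F^{-1}[\psi_k\,\mathcal F f](\cdot)\big|^q\Big)^{1/q}\,\Big|\,\mathcal M^u_p\Big\|,\qquad K\in\mathbb N_0\cup\{\infty\},$$ $$\|f\,|\,\mathcal E^s_{u,p,q}\|^{\clubsuit}_K := \big\|\mathcal F^{-1}[\varphi_0\,\mathcal F f]\,\big|\,\mathcal M^u_p\big\|+|f|_K,\qquad K\in\mathbb N_0\cup\{\infty\},$$ $$\|f\,|\,\mathcal E^s_{u,p,q}\|_K := 2^{-Ks}\,\big\|\mathcal F^{-1}[(D_{2^{K+1}}\varphi_0)\,\mathcal F f]\,\big|\,\mathcal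 M^u_p\big\|+|f|_K,\qquad K\in\mathbb N_0.$$ **Theorem.** For every $K\in\mathbb N_0$ the three expressions $\|\cdot\,|\,\mathcal E^s_{u,p,q}\|$, $\|\cdot\,|\,\mathcal E^s_{u,p,q}\|^{\clubsuit}_K$ and $\|\cdot\,|\,\mathcal E^s_{u,p,q}\|_K$ are mutually equivalent on $\mathcal S'(\mathbb R^d)$: each is bounded by a finite constant, not depending on $f$, times each other one, for all $f\in\mathcal S'(\mathbb R^d)$. In particular, $f\in\mathcal S'(\mathbb R^d)$ belongs to the Triebel-Lizorkin-Morrey space $\mathcal E^s_{u,p,q}(\mathbb R^d)=\{f\in\mathcal S'(\mathbb R^d):\|f\,|\,\mathcal E^s_{u,p,q}\|<\infty\}$ if and only if any one of the three expressions is finite. If $s>\sigma_p:=d\max\{0,\frac1p-1\}$, then also $\|\cdot\,|\,\mathcal E^s_{u,p,q}\|^{\clubsuit}_\infty$ and $\|\cdot\,|\,\mathcal E^s_{u,p,q}\|$ are equivalent on $\mathcal S'(\mathbb R^d)$. -/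

import Mathlib

open MeasureTheory
open scoped ENNReal NNReal ContDiff FourierTransform SchwartzMap

namespace TLM

noncomputable section

/-! ### Morrey (quasi-)norms and weighted sequence sums -/

/-- The Morrey (quasi-)norm `sup_{y, R > 0} |B(y,R)|^{1/u - 1/p} (∫_{B(y,R)} |g|^p)^{1/p}`,
with value in `[0, ∞]`, of a measurable function `g ≥ 0`. -/
def morreyNorm {d : ℕ} (u p : ℝ) (g : EuclideanSpace ℝ (Fin d) → ℝ≥0∞) : ℝ≥0∞ :=
  ⨆ (y : EuclideanSpace ℝ (Fin d)) (R : ℝ) (_ : 0 < R),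
    volume (Metric.ball y R) ^ (1 / u - 1 / p) *
      (∫⁻ x in Metric.ball y R, g x ^ p) ^ (1 / p)

/-- `(∑_i a_i^q)^{1/q}` for `0 < q < ∞`, and `sup_i a_i` for `q = ∞`. -/
def lqNorm {ι : Type*} (q : ℝ≥0∞) (a : ι → ℝ≥0∞) : ℝ≥0∞ :=
  if q = ⊤ then ⨆ i, a i else (∑' i, a i ^ q.toReal) ^ (1 / q.toReal)

/-- The weight `2^t`, for real `t`, as an extended nonnegative number. -/
def twoPow (t : ℝ) : ℝ≥0∞ := ENNReal.ofReal ((2 : ℝ) ^ t)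

/-! ### Dilations and the dyadic decomposition of unity -/

/-- The dilation `D_r g = g(r ·)`. -/
def dilate {d : ℕ} (r : ℝ) (g : EuclideanSpace ℝ (Fin d) → ℝ) : EuclideanSpace ℝ (Fin d) → ℝ :=
  fun x => g (r • x)

/-- A nonnegative smooth function with `φ₀ = 1` where `|x| ≤ a` and `φ₀ = 0` where `|x| ≥ b`. -/
structure IsCutoff {d : ℕ} (a b : ℝ) (φ₀ : EuclideanSpace ℝ (Fin d) → ℝ) : Prop where
  smooth : ContDiff ℝ ∞ φ₀
  nonneg : ∀ x, 0 ≤ φ₀ x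
  eq_one : ∀ x, ‖x‖ ≤ a → φ₀ x = 1
  eq_zero : ∀ x, b ≤ ‖x‖ → φ₀ x = 0

/-- `ψ = φ₀ - D_2 φ₀`. -/
def psi {d : ℕ} (φ₀ : EuclideanSpace ℝ (Fin d) → ℝ) : EuclideanSpace ℝ (Fin d) → ℝ :=
  fun x => φ₀ x - dilate 2 φ₀ x

/-- `ψ_k = D_{2^{-k}} ψ`, for `k ∈ ℤ`. -/
def psiDyadic {d : ℕ} (φ₀ : EuclideanSpace ℝ (Fin d) → ℝ) (k : ℤ) :
    EuclideanSpace ℝ (Fin d) → ℝ :=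
  dilate ((2 : ℝ) ^ (-k)) (psi φ₀)

/-- The smooth dyadic decomposition of unity: `φ₀` itself, and `φ_k = ψ_k` for `k ≥ 1`. -/
def phiDyadic {d : ℕ} (φ₀ : EuclideanSpace ℝ (Fin d) → ℝ) (k : ℕ) :
    EuclideanSpace ℝ (Fin d) → ℝ :=
  if k = 0 then φ₀ else psiDyadic φ₀ (k : ℤ)

/-! ### Tempered distributions that are continuous functions -/

/-- The tempered distribution `T` is induced by the continuous function `g`. -/
def IsInducedBy {d : ℕ} (T : 𝓢'(EuclideanSpace ℝ (Fin d), ℂ))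
    (g : EuclideanSpace ℝ (Fin d) → ℂ) : Prop :=
  Continuous g ∧ ∀ θ : 𝓢(EuclideanSpace ℝ (Fin d), ℂ),
    Integrable (fun x => θ x * g x) ∧ T θ = ∫ x, θ x * g x

/-- A tempered distribution is induced by at most one continuous function. -/
theorem IsInducedBy.unique {d : ℕ} {T : 𝓢'(EuclideanSpace ℝ (Fin d), ℂ)}
    {g h : EuclideanSpace ℝ (Fin d) → ℂ} (hg : IsInducedBy T g) (hh : IsInducedBy T h) :
    g = h := by
  refine (Continuous.ae_eq_iff_eq volume hg.1 hh.1).1 ?_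
  refine ae_eq_of_integral_contDiff_smul_eq hg.1.locallyIntegrable hh.1.locallyIntegrable ?_
  intro θ hθ hc
  have h₁ : HasCompactSupport (Complex.ofRealCLM ∘ θ) := hc.comp_left rfl
  have h₂ : ContDiff ℝ ∞ (Complex.ofRealCLM ∘ θ) := by fun_prop
  have e₁ := (hg.2 (h₁.toSchwartzMap h₂)).2
  have e₂ := (hh.2 (h₁.toSchwartzMap h₂)).2
  simpa [Complex.real_smul] using e₁.symm.trans e₂

open Classical in
/-- The continuous function that induces `T`. A distribution with compactly supported Fourier
transform has one; the value `0` for a distribution without one is never used below. -/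
def toFunction {d : ℕ} (T : 𝓢'(EuclideanSpace ℝ (Fin d), ℂ)) : EuclideanSpace ℝ (Fin d) → ℂ :=
  if h : ∃ g, IsInducedBy T g then h.choose else 0

/-- `toFunction T` is the continuous function inducing `T`, whenever there is one. -/
theorem IsInducedBy.toFunction_eq {d : ℕ} {T : 𝓢'(EuclideanSpace ℝ (Fin d), ℂ)}
    {g : EuclideanSpace ℝ (Fin d) → ℂ} (hg : IsInducedBy T g) : toFunction T = g := by
  have h : ∃ g, IsInducedBy T g := ⟨g, hg⟩
  rw [toFunction, dif_pos h]
  exact h.choose_spec.unique hg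

/-- The pointwise absolute value `x ↦ |𝓕⁻¹[η 𝓕 f](x)|`, for `η ∈ C_c^∞` and `f ∈ 𝓢'`. -/
def absBlock {d : ℕ} (η : EuclideanSpace ℝ (Fin d) → ℝ)
    (f : 𝓢'(EuclideanSpace ℝ (Fin d), ℂ)) : EuclideanSpace ℝ (Fin d) → ℝ≥0∞ :=
  fun x => ‖toFunction
    (𝓕⁻ (TemperedDistribution.smulLeftCLM ℂ (fun ξ => (η ξ : ℂ)) (𝓕 f))) x‖ₑ

/-! ### The (quasi-)norms -/

/-- The quasi-norm of the Triebel-Lizorkin-Morrey space `𝓔^s_{u,p,q}(ℝ^d)`, with values in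
`[0, ∞]`; the space consists of the `f ∈ 𝓢'` where it is finite. -/
def tlmNorm {d : ℕ} (φ₀ : EuclideanSpace ℝ (Fin d) → ℝ) (s u p : ℝ) (q : ℝ≥0∞)
    (f : 𝓢'(EuclideanSpace ℝ (Fin d), ℂ)) : ℝ≥0∞ :=
  morreyNorm u p fun x => lqNorm q fun k : ℕ =>
    twoPow ((k : ℝ) * s) * absBlock (phiDyadic φ₀ k) f x

/-- `|f|_K`, for `K ∈ ℤ ∪ {∞}`: the sum extends over the integers `k ≥ -K`. -/
def blockNorm {d : ℕ} (φ₀ : EuclideanSpace ℝ (Fin d) → ℝ) (s u p : ℝ) (q : ℝ≥0∞)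
    (K : WithTop ℤ) (f : 𝓢'(EuclideanSpace ℝ (Fin d), ℂ)) : ℝ≥0∞ :=
  morreyNorm u p fun x => lqNorm q fun k : {k : ℤ // ((-k : ℤ) : WithTop ℤ) ≤ K} =>
    twoPow ((k.1 : ℝ) * s) * absBlock (psiDyadic φ₀ k.1) f x

/-- `‖𝓕⁻¹[φ₀ 𝓕 f] | M^u_p‖ + |f|_K`. -/
def clubNorm {d : ℕ} (φ₀ : EuclideanSpace ℝ (Fin d) → ℝ) (s u p : ℝ) (q : ℝ≥0∞)
    (K : WithTop ℤ) (f : 𝓢'(EuclideanSpace ℝ (Fin d), ℂ)) : ℝ≥0∞ :=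
  morreyNorm u p (absBlock φ₀ f) + blockNorm φ₀ s u p q K f

/-- `2^{-Ks} ‖𝓕⁻¹[(D_{2^{K+1}} φ₀) 𝓕 f] | M^u_p‖ + |f|_K`. -/
def dilatedNorm {d : ℕ} (φ₀ : EuclideanSpace ℝ (Fin d) → ℝ) (s u p : ℝ) (q : ℝ≥0∞)
    (K : ℕ) (f : 𝓢'(EuclideanSpace ℝ (Fin d), ℂ)) : ℝ≥0∞ :=
  twoPow (-(K : ℝ) * s) * morreyNorm u p (absBlock (dilate ((2 : ℝ) ^ (K + 1)) φ₀) f) +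
    blockNorm φ₀ s u p q ((K : ℤ) : WithTop ℤ) f

/-- `N₁ ∼ N₂` on all of `X`, for functionals with values in `[0, ∞]`: two-sided estimates with a
finite constant that does not depend on the argument. In particular both are finite at the same
points. -/
def Equivalent {X : Type*} (N₁ N₂ : X → ℝ≥0∞) : Prop :=
  ∃ C : ℝ≥0, 0 < C ∧ ∀ f, N₁ f ≤ C * N₂ f ∧ N₂ f ≤ C * N₁ f

/-- `σ_p = d max{0, 1/p - 1}`. -/
def sigma (d : ℕ) (p : ℝ) : ℝ := (d : ℝ) * max 0 (1 / p - 1)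

end

end TLM

namespace TLM

open LineDeriv

/-! ### Mixed sequence norms -/

/-! All the functionals contain the blocks `ψ_k`, `k ≥ 1`, and differ only at low frequencies, so
the task is to compare `ψ_{-k}`, `k ≥ 0`, with `φ₀`.

For `k ≥ 1` the support of `ψ_{-k}` lies where `φ₀ = 1`. Hence `φ₀ ψ_{-k} = ψ_{-k}`, and the block
of `ψ_{-k}` is the block of `φ₀` integrated against translates of `𝓕 ψ_{-k}`. The multiplier
estimate `exists_morreyNorm_blockFun_le` bounds its Morrey norm by the `L^{min(1,p)}` quasi-norm of
that kernel. For `p ≥ 1` this is Jensen's inequality and translation invariance. For `p < 1` the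
integrand has Fourier support in a ball of radius `2b`, so its supremum is controlled by its `L¹`
norm, which yields a reverse Hölder inequality. By scaling (`kernel_norm_of_dilation`) the kernel
costs `2^{kσ_p}`. The term of index `-k` thus contributes at most a multiple of `2^{k(σ_p-s)}`:
harmless for finitely many `k`, and summable over all `k` if `s > σ_p` (`exists_blockNorm_le`).

For the dilated norm, `φ₀` also reproduces `D_{2^{K+1}} φ₀`; conversely `φ₀` is the telescoping sum
of `D_{2^{K+1}} φ₀` and `ψ_0, …, ψ_{-K}` (`morreyNorm_absBlock_rpow_le`).

Quasi-norms are added through their `r`-th powers, with `r` at most `1`, `p` and, where sequence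
norms are split, `q`. The distributional input is `isInducedBy_blockFun`: the block of `η` is `x ↦
f((𝓕 η)(· - x))`. -/

theorem rpow_tsum_le_tsum_rpow {ι : Type*} {t : ℝ} (ht : 0 < t) (ht1 : t ≤ 1) (a : ι → ℝ≥0∞) :
    (∑' i, a i) ^ t ≤ ∑' i, a i ^ t := by
  classical
  have key (S : Finset ι) : (∑ i ∈ S, a i) ^ t ≤ ∑ i ∈ S, a i ^ t := by
    induction S using Finset.induction_on with
    | empty => simp [ht]
    | insert i S hi ih =>
      rw [Finset.sum_insert hi, Finset.sum_insert hi]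
      exact (ENNReal.rpow_add_le_add_rpow _ _ ht.le ht1).trans (by gcongr)
  rw [← ENNReal.le_rpow_inv_iff ht, ENNReal.tsum_eq_iSup_sum]
  refine iSup_le fun S => (ENNReal.le_rpow_inv_iff ht).2 ((key S).trans ?_)
  exact ENNReal.sum_le_tsum S

/-- This is the embedding of `ℓ^r` into `ℓ^q` for `r ≤ q`, which replaces `q` by an exponent for
which Minkowski's inequality is available. -/
theorem lqNorm_rpow_le_tsum {ι : Type*} {q : ℝ≥0∞} {r : ℝ} (hr : 0 < r)
    (hrq : ENNReal.ofReal r ≤ q) (a : ι → ℝ≥0∞) : lqNorm q a ^ r ≤ ∑' i, a i ^ r := by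
  unfold lqNorm
  split_ifs with h
  · rw [← ENNReal.le_rpow_inv_iff hr]
    exact iSup_le fun i => (ENNReal.le_rpow_inv_iff hr).2 (ENNReal.le_tsum i)
  · have hrq' : r ≤ q.toReal := (ENNReal.ofReal_le_iff_le_toReal h).1 hrq
    have hq : 0 < q.toReal := hr.trans_le hrq'
    rw [← ENNReal.rpow_mul]
    refine (rpow_tsum_le_tsum_rpow (by positivity) ?_ _).trans_eq ?_
    · rw [one_div, inv_mul_le_one₀ hq]; exact hrq'
    · refine tsum_congr fun i => ?_
      rw [← ENNReal.rpow_mul]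
      congr 1
      field_simp

theorem le_lqNorm {ι : Type*} {q : ℝ≥0∞} (hq : 0 < q) (a : ι → ℝ≥0∞) (i : ι) :
    a i ≤ lqNorm q a := by
  unfold lqNorm
  split_ifs with h
  · exact le_iSup a i
  · have hq' : 0 < q.toReal := ENNReal.toReal_pos hq.ne' h
    rw [one_div, ENNReal.le_rpow_inv_iff hq']
    exact ENNReal.le_tsum (f := fun i => a i ^ q.toReal) i

theorem lqNorm_le_of_injective {ι κ : Type*} {q : ℝ≥0∞} {a : ι → ℝ≥0∞} {b : κ → ℝ≥0∞}
    {e : ι → κ} (he : Function.Injective e) (h : ∀ i, a i ≤ b (e i)) :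
    lqNorm q a ≤ lqNorm q b := by
  unfold lqNorm
  split_ifs
  · exact iSup_le fun i => (h i).trans (le_iSup b (e i))
  · refine ENNReal.rpow_le_rpow (le_trans ?_ (ENNReal.tsum_comp_le_tsum_of_injective he _))
      (by positivity)
    exact ENNReal.tsum_le_tsum fun i => ENNReal.rpow_le_rpow (h i) (by positivity)

theorem lqNorm_sumElim_rpow_le {α β : Type*} {q : ℝ≥0∞} {r : ℝ} (hr : 0 < r)
    (hrq : ENNReal.ofReal r ≤ q) (b : α → ℝ≥0∞) (c : β → ℝ≥0∞) :
    lqNorm q (Sum.elim b c) ^ r ≤ lqNorm q b ^ r + lqNorm q c ^ r := by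
  unfold lqNorm
  split_ifs with h
  · rw [iSup_sum]
    rcases le_total (⨆ i, b i) (⨆ j, c j) with hl | hl
    · simp only [Sum.elim_inl, Sum.elim_inr, sup_of_le_right hl]
      exact le_add_self
    · simp only [Sum.elim_inl, Sum.elim_inr, sup_of_le_left hl]
      exact le_self_add
  · have hrq' : r ≤ q.toReal := (ENNReal.ofReal_le_iff_le_toReal h).1 hrq
    have hq : 0 < q.toReal := hr.trans_le hrq'
    have e : ∑' i, Sum.elim b c i ^ q.toReal
        = ∑' i, b i ^ q.toReal + ∑' j, c j ^ q.toReal :=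
      Summable.tsum_sum (f := fun i => Sum.elim b c i ^ q.toReal)
        ENNReal.summable ENNReal.summable
    rw [e, ← ENNReal.rpow_mul, ← ENNReal.rpow_mul, ← ENNReal.rpow_mul]
    refine ENNReal.rpow_add_le_add_rpow _ _ (by positivity) ?_
    rw [one_div, inv_mul_le_one₀ hq]; exact hrq'

theorem measurable_lqNorm {X ι : Type*} [MeasurableSpace X] [Countable ι] (q : ℝ≥0∞)
    {g : ι → X → ℝ≥0∞} (hg : ∀ i, Measurable (g i)) :
    Measurable fun x => lqNorm q fun i => g i x := by
  unfold lqNorm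
  split_ifs
  · exact Measurable.iSup hg
  · exact (Measurable.tsum fun i => (hg i).pow_const _).pow_const _

/-! ### Minkowski's inequality for countable sums -/

theorem lintegral_rpow_tsum_le {X ι : Type*} [MeasurableSpace X] [Countable ι] (μ : Measure X)
    {t : ℝ} (ht : 1 ≤ t) {g : ι → X → ℝ≥0∞} (hg : ∀ i, Measurable (g i)) :
    (∫⁻ x, (∑' i, g i x) ^ t ∂μ) ^ (1 / t) ≤ ∑' i, (∫⁻ x, g i x ^ t ∂μ) ^ (1 / t) := by
  classical
  have ht0 : 0 < t := one_pos.trans_le ht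
  have key (S : Finset ι) :
      (∫⁻ x, (∑ i ∈ S, g i x) ^ t ∂μ) ^ (1 / t) ≤ ∑ i ∈ S, (∫⁻ x, g i x ^ t ∂μ) ^ (1 / t) := by
    induction S using Finset.induction_on with
    | empty => simp [ht0]
    | insert i S hi ih =>
      simp only [Finset.sum_insert hi]
      refine (ENNReal.lintegral_Lp_add_le (hg i).aemeasurable
        (Finset.measurable_fun_sum S fun j _ => hg j).aemeasurable ht).trans ?_
      gcongr
  have e (x : X) : (∑' i, g i x) ^ t = ⨆ S : Finset ι, (∑ i ∈ S, g i x) ^ t := by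
    rw [ENNReal.tsum_eq_iSup_sum]
    exact (ENNReal.orderIsoRpow t ht0).map_iSup _
  simp only [e]
  -- Monotone convergence along the directed family of finite partial sums.
  rw [lintegral_iSup_directed]
  · rw [one_div, ENNReal.rpow_inv_le_iff ht0]
    refine iSup_le fun S => (ENNReal.rpow_inv_le_iff ht0).1 ?_
    rw [← one_div]
    exact (key S).trans (ENNReal.sum_le_tsum S)
  · exact fun S => ((Finset.measurable_fun_sum S fun j _ => hg j).pow_const t).aemeasurable
  · refine Monotone.directed_le fun S T hST x => ?_
    exact ENNReal.rpow_le_rpow (Finset.sum_le_sum_of_subset hST) ht0.le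

/-! ### Morrey quasi-norms -/

section Morrey

variable {d : ℕ} {u p : ℝ}

local notation "E" => EuclideanSpace ℝ (Fin d)

theorem le_morreyNorm (g : E → ℝ≥0∞) (y : E) {R : ℝ} (hR : 0 < R) :
    volume (Metric.ball y R) ^ (1 / u - 1 / p) *
      (∫⁻ x in Metric.ball y R, g x ^ p) ^ (1 / p) ≤ morreyNorm u p g :=
  le_iSup₂_of_le y R (le_iSup_of_le hR le_rfl)

theorem morreyNorm_le {g : E → ℝ≥0∞} {M : ℝ≥0∞}
    (h : ∀ (y : E) (R : ℝ), 0 < R → volume (Metric.ball y R) ^ (1 / u - 1 / p) *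
      (∫⁻ x in Metric.ball y R, g x ^ p) ^ (1 / p) ≤ M) : morreyNorm u p g ≤ M :=
  iSup₂_le fun y R => iSup_le fun hR => h y R hR

theorem morreyNorm_mono (hp : 0 < p) {g h : E → ℝ≥0∞} (hgh : ∀ x, g x ≤ h x) :
    morreyNorm u p g ≤ morreyNorm u p h := by
  refine morreyNorm_le fun y R hR => le_trans ?_ (le_morreyNorm h y hR)
  gcongr with x
  exact hgh x

theorem morreyNorm_const_mul (hp : 0 < p) {c : ℝ≥0∞} (hc : c ≠ ⊤) (g : E → ℝ≥0∞) :
    morreyNorm u p (fun x => c * g x) = c * morreyNorm u p g := by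
  unfold morreyNorm
  simp only [ENNReal.mul_iSup]
  refine iSup_congr fun y => iSup_congr fun R => iSup_congr fun _ => ?_
  have e : ∫⁻ x in Metric.ball y R, (c * g x) ^ p = c ^ p * ∫⁻ x in Metric.ball y R, g x ^ p := by
    rw [← lintegral_const_mul' _ _ (ENNReal.rpow_ne_top_of_nonneg hp.le hc)]
    exact lintegral_congr fun x => ENNReal.mul_rpow_of_nonneg _ _ hp.le
  rw [e, ENNReal.mul_rpow_of_nonneg _ _ (by positivity), ← ENNReal.rpow_mul,
    mul_one_div_cancel hp.ne', ENNReal.rpow_one]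
  ring

/-- Since `p / r ≥ 1`, Minkowski's inequality in `L^{p/r}` applies to the `r`-th powers on each
ball. -/
theorem morreyNorm_rpow_le_tsum (hp : 0 < p) {ι : Type*} [Countable ι] {r : ℝ} (hr : 0 < r)
    (hrp : r ≤ p) {F : E → ℝ≥0∞} {g : ι → E → ℝ≥0∞} (hg : ∀ i, Measurable (g i))
    (h : ∀ x, F x ^ r ≤ ∑' i, g i x ^ r) :
    morreyNorm u p F ^ r ≤ ∑' i, morreyNorm u p (g i) ^ r := by
  rw [← ENNReal.le_rpow_inv_iff hr]
  refine morreyNorm_le fun y R hR => (ENNReal.le_rpow_inv_iff hr).2 ?_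
  rw [ENNReal.mul_rpow_of_nonneg _ _ hr.le]
  have ht : 1 ≤ p / r := (one_le_div hr).2 hrp
  have e₁ : (1 / p : ℝ) * r = 1 / (p / r) := by field_simp
  have e₂ (f : E → ℝ≥0∞) (x : E) : (f x ^ r) ^ (p / r) = f x ^ p := by
    rw [← ENNReal.rpow_mul, mul_div_cancel₀ _ hr.ne']
  calc _ ≤ (volume (Metric.ball y R) ^ (1 / u - 1 / p)) ^ r *
        (∫⁻ x in Metric.ball y R, (∑' i, g i x ^ r) ^ (p / r)) ^ (1 / (p / r)) := by
        rw [← ENNReal.rpow_mul (∫⁻ x in Metric.ball y R, F x ^ p), e₁]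
        gcongr with x
        rw [← e₂ F x]
        exact ENNReal.rpow_le_rpow (h x) (by positivity)
    _ ≤ (volume (Metric.ball y R) ^ (1 / u - 1 / p)) ^ r *
        ∑' i, (∫⁻ x in Metric.ball y R, (g i x ^ r) ^ (p / r)) ^ (1 / (p / r)) := by
        gcongr
        exact lintegral_rpow_tsum_le _ ht fun i => (hg i).pow_const r
    _ ≤ _ := by
        rw [← ENNReal.tsum_mul_left]
        refine ENNReal.tsum_le_tsum fun i => ?_
        simp only [e₂]
        rw [← e₁, ENNReal.rpow_mul, ← ENNReal.mul_rpow_of_nonneg _ _ hr.le]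
        exact ENNReal.rpow_le_rpow (le_morreyNorm (g i) y hR) hr.le

end Morrey

/-- A linear functional dominated by the norm of a linear map factors continuously through it. -/
theorem exists_continuousLinearMap_comp_eq {V Y : Type*} [AddCommGroup V] [Module ℂ V]
    [NormedAddCommGroup Y] [NormedSpace ℂ Y] (J : V →ₗ[ℂ] Y) (f : V →ₗ[ℂ] ℂ) {C : ℝ}
    (h : ∀ v, ‖f v‖ ≤ C * ‖J v‖) : ∃ L : Y →L[ℂ] ℂ, ∀ v, L (J v) = f v := by
  have hker : LinearMap.ker J ≤ LinearMap.ker f := fun v hv => by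
    have := h v
    rw [LinearMap.mem_ker.1 hv, norm_zero, mul_zero] at this
    exact LinearMap.mem_ker.2 (norm_le_zero_iff.1 this)
  let e := J.quotKerEquivRange
  let f' : LinearMap.range J →ₗ[ℂ] ℂ := ((LinearMap.ker J).liftQ f hker).comp e.symm.toLinearMap
  have hf' (v : V) : f' ⟨J v, v, rfl⟩ = f v := by
    have : e.symm ⟨J v, v, rfl⟩ = (LinearMap.ker J).mkQ v := by
      rw [LinearEquiv.symm_apply_eq]; rfl
    simp [f', this]
  have hb : ∀ y : LinearMap.range J, ‖f' y‖ ≤ C * ‖y‖ := by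
    rintro ⟨_, v, rfl⟩
    rw [hf']
    exact h v
  -- Hahn–Banach extends the functional from the range of `J` to all of `Y`.
  obtain ⟨L, hL, -⟩ := exists_extension_norm_eq (LinearMap.range J) (f'.mkContinuous C hb)
  refine ⟨L, fun v => ?_⟩
  have := hL ⟨J v, v, rfl⟩
  rw [← hf' v]
  simpa using this

/-! ### Translates of Schwartz functions -/

section Translation

variable {E : Type*} [NormedAddCommGroup E] [NormedSpace ℝ E]

theorem iteratedFDeriv_compSubConst (κ : 𝓢(E, ℂ)) (n : ℕ) (x ξ : E) :
    iteratedFDeriv ℝ n (κ.compSubConstCLM ℂ x) ξ = iteratedFDeriv ℝ n κ (ξ - x) :=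
  iteratedFDeriv_comp_sub (f := κ) n x ξ

/-- Seminorms of translates grow polynomially. -/
theorem exists_seminorm_compSubConst_le (κ : 𝓢(E, ℂ)) (k n : ℕ) :
    ∃ C : ℝ, 0 ≤ C ∧ ∀ x, SchwartzMap.seminorm ℂ k n (κ.compSubConstCLM ℂ x) ≤
      C * (1 + ‖x‖) ^ k := by
  refine ⟨2 ^ k * ((Finset.Iic (k, n)).sup fun m => SchwartzMap.seminorm ℂ m.1 m.2) κ,
    by positivity, fun x => ?_⟩
  refine SchwartzMap.seminorm_le_bound ℂ k n _ (by positivity) fun ξ => ?_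
  rw [iteratedFDeriv_compSubConst]
  have h₁ : ‖ξ‖ ≤ (1 + ‖x‖) * (1 + ‖ξ - x‖) := by
    have := norm_add_le x (ξ - x)
    rw [add_sub_cancel] at this
    nlinarith [norm_nonneg x, norm_nonneg (ξ - x)]
  have h₂ := SchwartzMap.one_add_le_sup_seminorm_apply (𝕜 := ℂ) (m := (k, n)) le_rfl le_rfl κ (ξ - x)
  calc ‖ξ‖ ^ k * ‖iteratedFDeriv ℝ n κ (ξ - x)‖
      ≤ ((1 + ‖x‖) * (1 + ‖ξ - x‖)) ^ k * ‖iteratedFDeriv ℝ n κ (ξ - x)‖ := by gcongr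
    _ = ((1 + ‖ξ - x‖) ^ k * ‖iteratedFDeriv ℝ n κ (ξ - x)‖) * (1 + ‖x‖) ^ k := by rw [mul_pow]; ring
    _ ≤ _ := by gcongr

/-- Translation of a Schwartz function is continuous in the Schwartz topology. -/
theorem continuous_compSubConst (κ : 𝓢(E, ℂ)) :
    Continuous fun x : E => κ.compSubConstCLM ℂ x := by
  rw [continuous_iff_continuousAt]
  intro x₀
  rw [ContinuousAt, (schwartz_withSeminorms ℂ E ℂ).tendsto_nhds _ _]
  rintro ⟨k, n⟩ ε hε
  obtain ⟨C, hC0, hC⟩ := exists_seminorm_compSubConst_le κ k (n + 1)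
  -- This bounds the derivatives of order `n + 1` of all translates by `z` in the closed unit ball
  -- around `x₀`, where `1 + ‖z‖ ≤ 2 + ‖x₀‖`; the mean value inequality then gives `hb`.
  let M := C * (2 + ‖x₀‖) ^ k
  have hM : 0 ≤ M := by positivity
  have hb : ∀ x, ‖x - x₀‖ ≤ 1 →
      SchwartzMap.seminorm ℂ k n (κ.compSubConstCLM ℂ x - κ.compSubConstCLM ℂ x₀)
        ≤ M * ‖x - x₀‖ := by
    intro x hx
    refine SchwartzMap.seminorm_le_bound ℂ k n _ (by positivity) fun ξ => ?_
    have e : iteratedFDeriv ℝ n (κ.compSubConstCLM ℂ x - κ.compSubConstCLM ℂ x₀ : 𝓢(E, ℂ)) ξ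
        = iteratedFDeriv ℝ n κ (ξ - x) - iteratedFDeriv ℝ n κ (ξ - x₀) := by
      rw [← iteratedFDeriv_compSubConst, ← iteratedFDeriv_compSubConst]
      exact iteratedFDeriv_sub_apply (((κ.compSubConstCLM ℂ x).smooth n).contDiffAt)
        (((κ.compSubConstCLM ℂ x₀).smooth n).contDiffAt)
    rw [e, ← norm_norm ξ, ← norm_pow, ← norm_smul, smul_sub]
    have hd : Differentiable ℝ (iteratedFDeriv ℝ n κ) :=
      (κ.smooth ⊤).differentiable_iteratedFDeriv (mod_cast ENat.natCast_lt_top n)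
    refine (convex_closedBall x₀ 1).norm_image_sub_le_of_norm_hasFDerivWithin_le
      (f := fun z => ‖ξ‖ ^ k • iteratedFDeriv ℝ n κ (ξ - z))
      (f' := fun z => ‖ξ‖ ^ k • -fderiv ℝ (iteratedFDeriv ℝ n κ) (ξ - z)) ?_ ?_ ?_ ?_
    · intro z _
      have h : HasFDerivAt (fun z => iteratedFDeriv ℝ n κ (ξ - z))
          (-fderiv ℝ (iteratedFDeriv ℝ n κ) (ξ - z)) z := by
        simpa [Function.comp_def] using (hd (ξ - z)).hasFDerivAt.comp z ((hasFDerivAt_id z).const_sub ξ)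
      exact (h.const_smul (‖ξ‖ ^ k)).hasFDerivWithinAt
    · intro z hz
      rw [norm_smul, norm_neg, norm_fderiv_iteratedFDeriv, norm_pow, norm_norm,
        ← iteratedFDeriv_compSubConst]
      refine (SchwartzMap.le_seminorm ℂ k (n + 1) (κ.compSubConstCLM ℂ z) ξ).trans
        ((hC z).trans ?_)
      have : ‖z‖ ≤ ‖x₀‖ + 1 := by
        have := norm_le_norm_add_norm_sub x₀ z
        rw [mem_closedBall_iff_norm, norm_sub_rev] at hz
        linarith [norm_sub_rev x₀ z]
      refine mul_le_mul_of_nonneg_left (pow_le_pow_left₀ (by positivity) (by linarith) k) hC0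
    · simp
    · simpa [dist_eq_norm] using hx
  have hδ : 0 < min 1 (ε / (M + 1)) := by positivity
  filter_upwards [Metric.ball_mem_nhds x₀ hδ] with x hx
  rw [mem_ball_iff_norm, lt_min_iff] at hx
  refine (hb x hx.1.le).trans_lt ?_
  have := (lt_div_iff₀ (by positivity : 0 < M + 1)).1 hx.2
  nlinarith [norm_nonneg (x - x₀)]

end Translation

noncomputable section

/-! ### Weighted derivatives in a Banach space -/

section Jets

variable {E : Type*} [NormedAddCommGroup E] [NormedSpace ℝ E]

variable (E) in
/-- Bounded continuous functions with values in the `n`-linear forms. -/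
abbrev JetSpace (n : ℕ) : Type _ :=
  @BoundedContinuousFunction E (E [×n]→L[ℝ] ℂ) _ SeminormedAddCommGroup.toPseudoMetricSpace

/-- The weighted derivative `ξ ↦ ‖ξ‖^k D^n v(ξ)` of a Schwartz function, as a bounded continuous
function. -/
def weightedJetFun (k n : ℕ) (v : 𝓢(E, ℂ)) : JetSpace E n :=
  BoundedContinuousFunction.ofNormedAddCommGroup
    (fun ξ : E => ‖ξ‖ ^ k • iteratedFDeriv ℝ n v ξ)
    ((continuous_norm.pow k).smul ((v.smooth ⊤).continuous_iteratedFDeriv (mod_cast le_top)))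
    (SchwartzMap.seminorm ℂ k n v) (fun ξ => by
      rw [norm_smul, norm_pow, norm_norm]; exact v.le_seminorm ℂ k n ξ)

/-- `weightedJetFun` as a continuous linear map. -/
def weightedJet (k n : ℕ) : 𝓢(E, ℂ) →L[ℂ] JetSpace E n :=
  SchwartzMap.mkCLMtoNormedSpace (D := E) (𝕜 := ℂ) (weightedJetFun k n)
    (fun v w => by
      ext1 ξ
      have : iteratedFDeriv ℝ n (v + w : 𝓢(E, ℂ)) ξ
          = iteratedFDeriv ℝ n v ξ + iteratedFDeriv ℝ n w ξ :=
        iteratedFDeriv_add_apply (v.smooth n).contDiffAt (w.smooth n).contDiffAt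
      change ‖ξ‖ ^ k • iteratedFDeriv ℝ n (v + w : 𝓢(E, ℂ)) ξ = _
      rw [this, smul_add]
      rfl)
    (fun c v => by
      ext1 ξ
      have : iteratedFDeriv ℝ n (c • v : 𝓢(E, ℂ)) ξ = c • iteratedFDeriv ℝ n v ξ :=
        iteratedFDeriv_const_smul_apply (v.smooth n).contDiffAt
      change ‖ξ‖ ^ k • iteratedFDeriv ℝ n (c • v : 𝓢(E, ℂ)) ξ = _
      rw [this, smul_comm]
      rfl)
    ⟨{(k, n)}, 1, zero_le_one, fun v => by
      rw [Finset.sup_singleton, one_mul]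
      exact BoundedContinuousFunction.norm_ofNormedAddCommGroup_le _
        (apply_nonneg (SchwartzMap.seminorm ℂ k n) v) _⟩

theorem weightedJet_apply (k n : ℕ) (v : 𝓢(E, ℂ)) (ξ : E) :
    weightedJet k n v ξ = ‖ξ‖ ^ k • iteratedFDeriv ℝ n v ξ := rfl

theorem norm_weightedJet (k n : ℕ) (v : 𝓢(E, ℂ)) :
    ‖weightedJet k n v‖ = SchwartzMap.seminorm ℂ k n v := by
  refine le_antisymm ?_ ?_
  · refine (BoundedContinuousFunction.norm_le (by positivity)).2 fun ξ => ?_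
    rw [weightedJet_apply, norm_smul, norm_pow, norm_norm]
    exact v.le_seminorm ℂ k n ξ
  · refine SchwartzMap.seminorm_le_bound ℂ k n v (norm_nonneg _) fun ξ => ?_
    have := (weightedJet k n v).norm_coe_le_norm ξ
    rwa [weightedJet_apply, norm_smul, norm_pow, norm_norm] at this

variable (E) in
/-- Finite families of bounded continuous functions, indexed by pairs of a weight and an order. -/
def Jets (s : Finset (ℕ × ℕ)) : Type _ := Π i : s, JetSpace E i.1.2

instance (s : Finset (ℕ × ℕ)) : NormedAddCommGroup (Jets E s) :=
  inferInstanceAs (NormedAddCommGroup (Π i : s, JetSpace E i.1.2))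

instance (s : Finset (ℕ × ℕ)) : NormedSpace ℂ (Jets E s) :=
  inferInstanceAs (NormedSpace ℂ (Π i : s, JetSpace E i.1.2))

instance (s : Finset (ℕ × ℕ)) : CompleteSpace (Jets E s) :=
  inferInstanceAs (CompleteSpace (Π i : s, JetSpace E i.1.2))

/-- A finite family of weighted derivatives of a Schwartz function. -/
def weightedJets (s : Finset (ℕ × ℕ)) : 𝓢(E, ℂ) →L[ℂ] Jets E s :=
  ContinuousLinearMap.pi (φ := fun i : s => JetSpace E i.1.2) fun i => weightedJet i.1.1 i.1.2

/-- Evaluation of a component of a family of jets at a point and at a tuple of vectors. -/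
def jetEval {s : Finset (ℕ × ℕ)} (i : s) (ξ : E) (m : Fin i.1.2 → E) : Jets E s →L[ℝ] ℂ :=
  (ContinuousMultilinearMap.apply ℝ (fun _ : Fin i.1.2 => E) ℂ m).comp
    ((BoundedContinuousFunction.evalCLM ℝ ξ).comp
      (ContinuousLinearMap.proj (φ := fun i : s => JetSpace E i.1.2) i))

theorem jetEval_smul_weightedJets {s : Finset (ℕ × ℕ)} (i : s) (ξ : E) (m : Fin i.1.2 → E) (c : ℂ)
    (v : 𝓢(E, ℂ)) : jetEval i ξ m (c • weightedJets s v)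
      = c * (‖ξ‖ ^ i.1.1 * iteratedFDeriv ℝ i.1.2 v ξ m) := by
  change c • (‖ξ‖ ^ i.1.1 • iteratedFDeriv ℝ i.1.2 v ξ m) = _
  rw [smul_eq_mul, Complex.real_smul, Complex.ofReal_pow]

/-- Point evaluations separate the space, so an identity between Bochner integrals reduces to scalar
integrals. -/
theorem Jets.ext_of_jetEval {s : Finset (ℕ × ℕ)} {y y' : Jets E s}
    (h : ∀ i ξ m, jetEval i ξ m y = jetEval i ξ m y') : y = y' :=
  funext fun i => BoundedContinuousFunction.ext fun ξ => ContinuousMultilinearMap.ext fun m =>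
    h i ξ m

/-- A continuous functional on the Schwartz space is bounded by finitely many seminorms, hence by
this norm, and so factors through `Jets E s`. -/
theorem sup_seminorm_le_norm_weightedJets (s : Finset (ℕ × ℕ)) (v : 𝓢(E, ℂ)) :
    s.sup (schwartzSeminormFamily ℂ E ℂ) v ≤ ‖weightedJets s v‖ := by
  refine Seminorm.finset_sup_apply_le (norm_nonneg _) fun i hi => ?_
  refine (norm_weightedJet i.1 i.2 v).symm.le.trans ?_
  exact norm_le_pi_norm (G := fun i : s => JetSpace E i.1.2) (weightedJets s v) ⟨i, hi⟩

theorem exists_norm_weightedJets_compSubConst_le (s : Finset (ℕ × ℕ)) (κ : 𝓢(E, ℂ)) :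
    ∃ (C : ℝ) (N : ℕ), ∀ x, ‖weightedJets s (κ.compSubConstCLM ℂ x)‖ ≤ C * (1 + ‖x‖) ^ N := by
  choose C hC0 hC using fun i : s => exists_seminorm_compSubConst_le κ i.1.1 i.1.2
  refine ⟨∑ i, C i, ∑ i : s, i.1.1, fun x => ?_⟩
  have hs : 0 ≤ ∑ i, C i := Finset.sum_nonneg fun i _ => hC0 i
  refine (pi_norm_le_iff_of_nonneg (G := fun i : s => JetSpace E i.1.2) (by positivity)).2 fun i => ?_
  refine (norm_weightedJet i.1.1 i.1.2 _).le.trans ((hC i x).trans ?_)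
  gcongr
  · exact Finset.single_le_sum (fun i _ => hC0 i) (Finset.mem_univ i)
  · linarith [norm_nonneg x]
  · exact Finset.single_le_sum (f := fun i : s => i.1.1) (fun _ _ => Nat.zero_le _)
      (Finset.mem_univ i)

end Jets

/-! ### Tempered distributions and convolution integrals -/

section Convolution

variable {E : Type*} [NormedAddCommGroup E] [InnerProductSpace ℝ E] [FiniteDimensional ℝ E]
  [MeasurableSpace E] [BorelSpace E]

/-- The convolution of scalar Schwartz functions. -/
abbrev conv (θ κ : 𝓢(E, ℂ)) : 𝓢(E, ℂ) :=
  SchwartzMap.convolution (ContinuousLinearMap.mul ℂ ℂ) θ κ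

theorem conv_apply (θ κ : 𝓢(E, ℂ)) (y : E) : conv θ κ y = ∫ x, θ x * κ (y - x) :=
  SchwartzMap.convolution_apply (ContinuousLinearMap.mul ℂ ℂ) θ κ y

/-- On the Fourier side the convolution is a product and the derivative multiplies by a linear
symbol, which can be attached to either factor. -/
theorem lineDerivOp_conv (θ κ : 𝓢(E, ℂ)) (m : E) : ∂_{m} (conv θ κ) = conv θ (∂_{m} κ) := by
  have hm : (inner ℝ · m : E → ℝ).HasTemperateGrowth := by fun_prop
  have h₁ : 𝓕 (∂_{m} (conv θ κ)) = 𝓕 (conv θ (∂_{m} κ)) := by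
    rw [SchwartzMap.fourier_convolution, SchwartzMap.fourier_lineDerivOp_eq,
      SchwartzMap.fourier_convolution, SchwartzMap.fourier_lineDerivOp_eq]
    ext ξ
    simp [hm]
    ring
  simpa using congrArg (fun v : 𝓢(E, ℂ) => 𝓕⁻ v) h₁

theorem iteratedLineDerivOp_conv (θ κ : 𝓢(E, ℂ)) {n : ℕ} (m : Fin n → E) :
    ∂^{m} (conv θ κ) = conv θ (∂^{m} κ) := by
  induction n with
  | zero => simp
  | succ n ih =>
    rw [iteratedLineDerivOp_succ_left, iteratedLineDerivOp_succ_left, ih, lineDerivOp_conv]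

theorem iteratedFDeriv_conv_apply (θ κ : 𝓢(E, ℂ)) {n : ℕ} (m : Fin n → E) (y : E) :
    iteratedFDeriv ℝ n (conv θ κ) y m = ∫ x, θ x * iteratedFDeriv ℝ n κ (y - x) m := by
  rw [← SchwartzMap.iteratedLineDerivOp_eq_iteratedFDeriv, iteratedLineDerivOp_conv, conv_apply]
  simp only [SchwartzMap.iteratedLineDerivOp_eq_iteratedFDeriv]

theorem integrable_mul_one_add_norm_pow (θ : 𝓢(E, ℂ)) (N : ℕ) :
    Integrable fun x => ‖θ x‖ * (1 + ‖x‖) ^ N := by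
  have h : Integrable fun x => 2 ^ (N - 1) * (‖θ x‖ + ‖x‖ ^ N * ‖θ x‖) :=
    (θ.integrable.norm.add (θ.integrable_pow_mul volume N)).const_mul _
  refine h.mono' (by fun_prop) (Filter.Eventually.of_forall fun x => ?_)
  rw [Real.norm_of_nonneg (by positivity)]
  have := add_pow_le zero_le_one (norm_nonneg x) N
  rw [one_pow] at this
  nlinarith [norm_nonneg (θ x)]

/-- A functional that factors through a Banach space, in which convolutions are Bochner integrals,
can be taken under the integral that defines a convolution. -/
theorem integral_mul_compSubConst_of_factor {Y : Type*} [NormedAddCommGroup Y] [NormedSpace ℂ Y]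
    [CompleteSpace Y] (f : 𝓢(E, ℂ) → ℂ) (J : 𝓢(E, ℂ) →L[ℂ] Y) (L : Y →L[ℂ] ℂ)
    (hL : ∀ v, L (J v) = f v) (θ κ : 𝓢(E, ℂ)) {A : ℝ} {N : ℕ}
    (hA : ∀ x, ‖J (κ.compSubConstCLM ℂ x)‖ ≤ A * (1 + ‖x‖) ^ N)
    {ι : Type*} (ev : ι → Y →L[ℝ] ℂ) (hev : ∀ y y', (∀ i, ev i y = ev i y') → y = y')
    (hJ : ∀ i, ∫ x, ev i (θ x • J (κ.compSubConstCLM ℂ x)) = ev i (J (conv θ κ))) :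
    Integrable (fun x => θ x * f (κ.compSubConstCLM ℂ x)) ∧
      ∫ x, θ x * f (κ.compSubConstCLM ℂ x) = f (conv θ κ) := by
  have hcont : Continuous fun x => θ x • J (κ.compSubConstCLM ℂ x) :=
    θ.continuous.smul (J.continuous.comp (continuous_compSubConst κ))
  have hint : Integrable fun x => θ x • J (κ.compSubConstCLM ℂ x) := by
    refine ((integrable_mul_one_add_norm_pow θ N).const_mul A).mono' hcont.aestronglyMeasurable
      (Filter.Eventually.of_forall fun x => ?_)
    rw [norm_smul]
    have := mul_le_mul_of_nonneg_left (hA x) (norm_nonneg (θ x))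
    linarith
  have hval : ∫ x, θ x • J (κ.compSubConstCLM ℂ x) = J (conv θ κ) := by
    refine hev _ _ fun i => ?_
    rw [← (ev i).integral_comp_comm hint, hJ]
  have e (x : E) : θ x * f (κ.compSubConstCLM ℂ x) = L (θ x • J (κ.compSubConstCLM ℂ x)) := by
    rw [map_smul, hL, smul_eq_mul]
  simp only [e]
  refine ⟨L.integrable_comp hint, ?_⟩
  rw [L.integral_comp_comm hint, hval, hL]

/-- A continuous linear functional on the Schwartz space can be taken under the integral that
defines a convolution. -/
theorem integral_mul_compSubConst (f : 𝓢(E, ℂ) →L[ℂ] ℂ) (θ κ : 𝓢(E, ℂ)) :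
    Integrable (fun x => θ x * f (κ.compSubConstCLM ℂ x)) ∧
      ∫ x, θ x * f (κ.compSubConstCLM ℂ x) = f (conv θ κ) := by
  obtain ⟨s, C, -, hf⟩ := Seminorm.bound_of_continuous (schwartz_withSeminorms ℂ E ℂ)
    ((normSeminorm ℂ ℂ).comp f.toLinearMap) (continuous_norm.comp f.continuous)
  have hb (v : 𝓢(E, ℂ)) : ‖f v‖ ≤ C * ‖weightedJets s v‖ :=
    (hf v).trans (mul_le_mul_of_nonneg_left (sup_seminorm_le_norm_weightedJets s v) C.2)
  obtain ⟨L, hL⟩ := exists_continuousLinearMap_comp_eq (weightedJets s).toLinearMap f.toLinearMap hb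
  obtain ⟨A, N, hA⟩ := exists_norm_weightedJets_compSubConst_le s κ
  refine integral_mul_compSubConst_of_factor f (weightedJets s) L hL θ κ hA
    (ι := Σ i : s, E × (Fin i.1.2 → E)) (fun t => jetEval t.1 t.2.1 t.2.2)
    (fun y y' h => Jets.ext_of_jetEval fun i ξ m => h ⟨i, ξ, m⟩) ?_
  rintro ⟨i, ξ, m⟩
  have := jetEval_smul_weightedJets i ξ m 1 (conv θ κ)
  rw [one_smul, one_mul] at this
  simp only [jetEval_smul_weightedJets, this]
  rw [iteratedFDeriv_conv_apply, ← integral_const_mul]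
  refine integral_congr_ae (Filter.Eventually.of_forall fun x => ?_)
  simp only [iteratedFDeriv_compSubConst]
  ring

end Convolution

/-! ### The function inducing a frequency block -/

section Blocks

variable {d : ℕ}

local notation "E" => EuclideanSpace ℝ (Fin d)

/-- After one more Fourier transform both sides are the product of the reflection of `η` and `𝓕 θ`,
because `𝓕 𝓕` is reflection. -/
theorem fourier_mul_fourierInv (η θ : 𝓢(E, ℂ)) :
    𝓕 (SchwartzMap.smulLeftCLM ℂ η (𝓕⁻ θ)) = conv θ (𝓕 η) := by
  have hneg (v : 𝓢(E, ℂ)) (x : E) : 𝓕 v x = 𝓕⁻ v (-x) := by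
    rw [SchwartzMap.fourier_coe, SchwartzMap.fourierInv_coe, Real.fourierInv_eq_fourier_neg,
      neg_neg]
  have h : 𝓕 (𝓕 (SchwartzMap.smulLeftCLM ℂ η (𝓕⁻ θ))) = 𝓕 (conv θ (𝓕 η)) := by
    rw [SchwartzMap.fourier_convolution]
    ext x
    rw [hneg, SchwartzMap.pairing_apply_apply, hneg θ, hneg (𝓕 η)]
    simp [η.hasTemperateGrowth, mul_comm]
  simpa using congrArg (fun v : 𝓢(E, ℂ) => 𝓕⁻ v) h

/-- The function that induces `𝓕⁻¹[η 𝓕 f]`. -/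
def blockFun (η : 𝓢(E, ℂ)) (f : 𝓢'(E, ℂ)) : E → ℂ :=
  fun x => f ((𝓕 η : 𝓢(E, ℂ)).compSubConstCLM ℂ x)

/-- Moving every operation onto the test function leaves `f` applied to `conv θ (𝓕 η)`, and `f` can
be taken under that integral. -/
theorem isInducedBy_blockFun (η : 𝓢(E, ℂ)) (f : 𝓢'(E, ℂ)) :
    IsInducedBy (𝓕⁻ (TemperedDistribution.smulLeftCLM ℂ η (𝓕 f))) (blockFun η f) := by
  refine ⟨(map_continuous f).comp (continuous_compSubConst _), fun θ => ?_⟩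
  obtain ⟨h₁, h₂⟩ := integral_mul_compSubConst
    ⟨⟨⟨f, map_add f⟩, map_smul f⟩, map_continuous f⟩ θ (𝓕 η)
  refine ⟨h₁, Eq.trans ?_ h₂.symm⟩
  rw [← fourier_mul_fourierInv]
  rfl

end Blocks

end

/-! ### Integral inequalities -/

/-- A function bounded by a multiple of its `L¹` norm satisfies a reverse Hölder inequality. -/
theorem lintegral_rpow_le_of_le_mul_lintegral {X : Type*} [MeasurableSpace X] {μ : Measure X}
    {h : X → ℝ≥0∞} {V : ℝ≥0∞} (hV : V ≠ ⊤) (hfin : ∫⁻ x, h x ∂μ ≠ ⊤)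
    (hle : ∀ x, h x ≤ V * ∫⁻ x, h x ∂μ) {p : ℝ} (hp : 0 < p) (hp1 : p ≤ 1) :
    (∫⁻ x, h x ∂μ) ^ p ≤ V ^ (1 - p) * ∫⁻ x, h x ^ p ∂μ := by
  set N := ∫⁻ x, h x ∂μ with hN
  rcases eq_or_ne N 0 with h0 | h0
  · simp [h0, hp]
  have h1p : 0 ≤ 1 - p := by linarith
  have hNfin : N ^ (1 - p) ≠ ⊤ := ENNReal.rpow_ne_top_of_nonneg h1p hfin
  -- Write `h = h^{1-p} h^p` and apply the supremum bound to the first factor only; the resulting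
  -- `N^{1-p}` is cancelled at the end.
  have hpt (x : X) : h x ≤ (V * N) ^ (1 - p) * h x ^ p := by
    calc h x = h x ^ (1 - p) * h x ^ p := by
          rw [← ENNReal.rpow_add_of_nonneg _ _ h1p hp.le, sub_add_cancel, ENNReal.rpow_one]
      _ ≤ _ := by gcongr; exact hle x
  have hmain : N ^ p * N ^ (1 - p) ≤ (V ^ (1 - p) * ∫⁻ x, h x ^ p ∂μ) * N ^ (1 - p) := by
    calc N ^ p * N ^ (1 - p) = N := by
          rw [← ENNReal.rpow_add_of_nonneg _ _ hp.le h1p, add_sub_cancel, ENNReal.rpow_one]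
      _ ≤ ∫⁻ x, (V * N) ^ (1 - p) * h x ^ p ∂μ := lintegral_mono hpt
      _ = _ := by
          rw [lintegral_const_mul' _ _
            (ENNReal.rpow_ne_top_of_nonneg h1p (ENNReal.mul_ne_top hV hfin)),
            ENNReal.mul_rpow_of_nonneg _ _ h1p]
          ring
  exact (ENNReal.mul_le_mul_iff_left (ENNReal.rpow_pos (pos_iff_ne_zero.2 h0) hfin).ne' hNfin).1
    hmain

/-- Jensen's inequality for a power, with respect to an unnormalised weight. -/
theorem lintegral_mul_rpow_le {X : Type*} [MeasurableSpace X] {μ : Measure X}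
    {k h : X → ℝ≥0∞} (hk : Measurable k) (hh : Measurable h) {p : ℝ} (hp : 1 ≤ p) :
    (∫⁻ x, k x * h x ∂μ) ^ p ≤ (∫⁻ x, k x ∂μ) ^ (p - 1) * ∫⁻ x, k x * h x ^ p ∂μ := by
  rcases hp.eq_or_lt with rfl | hp
  · simp
  -- With `k` absorbed into the measure, the claim is Hölder's inequality against the constant `1`.
  have e (f : X → ℝ≥0∞) (hf : Measurable f) :
      ∫⁻ x, k x * f x ∂μ = ∫⁻ x, f x ∂(μ.withDensity k) :=
    (lintegral_withDensity_eq_lintegral_mul μ hk hf).symm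
  have e' : ∫⁻ x, k x ∂μ = ∫⁻ x, 1 ∂(μ.withDensity k) := by
    rw [← e _ measurable_const]; simp
  rw [e h hh, e _ (hh.pow_const p), e']
  have hc := Real.HolderConjugate.conjExponent hp
  have := ENNReal.lintegral_mul_le_Lp_mul_Lq (μ.withDensity k) hc hh.aemeasurable
    (g := fun _ => 1) aemeasurable_const
  have hp0 : 0 < p := by linarith
  simp only [Pi.mul_apply, mul_one, ENNReal.one_rpow] at this
  refine (ENNReal.rpow_le_rpow this hp0.le).trans_eq ?_
  rw [ENNReal.mul_rpow_of_nonneg _ _ hp0.le, ← ENNReal.rpow_mul, ← ENNReal.rpow_mul,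
    one_div_mul_cancel hp0.ne', ENNReal.rpow_one, mul_comm]
  congr 2
  unfold Real.conjExponent
  have : p - 1 ≠ 0 := by linarith
  field_simp

/-! ### Averages of translates in Morrey spaces -/

section Morrey

variable {d : ℕ} {u p : ℝ}

local notation "E" => EuclideanSpace ℝ (Fin d)

theorem setLIntegral_ball_comp_add_right (h : E → ℝ≥0∞) (y w : E) (R : ℝ) :
    ∫⁻ x in Metric.ball y R, h (x + w) = ∫⁻ x in Metric.ball (y + w) R, h x := by
  rw [← lintegral_indicator measurableSet_ball, ← lintegral_indicator measurableSet_ball,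
    ← lintegral_add_right_eq_self ((Metric.ball (y + w) R).indicator h) w]
  refine lintegral_congr fun x => ?_
  simp [Set.indicator, Metric.mem_ball]

/-- A pointwise bound by a weighted average of translates is inherited by Morrey quasi-norms. -/
theorem morreyNorm_le_of_rpow_le (hp : 0 < p) {g h k : E → ℝ≥0∞} (hh : Measurable h)
    (hk : Measurable k) {A : ℝ≥0∞} (hA : A ≠ ⊤)
    (hg : ∀ x, g x ^ p ≤ A * ∫⁻ w, k w * h (x + w) ^ p) :
    morreyNorm u p g ≤ (A * ∫⁻ w, k w) ^ (1 / p) * morreyNorm u p h := by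
  refine morreyNorm_le fun y R hR => ?_
  set M := morreyNorm u p h
  obtain ⟨c, hc⟩ : ∃ c, c = volume (Metric.ball y R) ^ (1 / u - 1 / p) := ⟨_, rfl⟩
  rw [← hc]
  have hc_top : c ≠ ⊤ := hc ▸ ENNReal.rpow_ne_top_of_ne_zero
    (Metric.measure_ball_pos volume y hR).ne' measure_ball_lt_top.ne
  have hcp : c ^ p ≠ ⊤ := ENNReal.rpow_ne_top_of_nonneg hp.le hc_top
  -- A translated ball has the same volume, so the Morrey norm of `h` bounds all translates at once.
  have hball (w : E) : c ^ p * ∫⁻ x in Metric.ball y R, h (x + w) ^ p ≤ M ^ p := by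
    rw [setLIntegral_ball_comp_add_right (fun x => h x ^ p), hc,
      Measure.addHaar_ball_center volume y, ← Measure.addHaar_ball_center volume (y + w)]
    refine le_trans (le_of_eq ?_) (ENNReal.rpow_le_rpow (le_morreyNorm h (y + w) hR) hp.le)
    rw [ENNReal.mul_rpow_of_nonneg _ _ hp.le, ← ENNReal.rpow_mul (∫⁻ x in _, _),
      one_div_mul_cancel hp.ne', ENNReal.rpow_one]
  have hm : Measurable (Function.uncurry fun (x w : E) => k w * h (x + w) ^ p) := by fun_prop
  have key : c ^ p * ∫⁻ x in Metric.ball y R, g x ^ p ≤ (A * ∫⁻ w, k w) * M ^ p := by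
    calc c ^ p * ∫⁻ x in Metric.ball y R, g x ^ p
        ≤ c ^ p * ∫⁻ x in Metric.ball y R, A * ∫⁻ w, k w * h (x + w) ^ p := by
          gcongr with x
          exact hg x
      _ = A * ∫⁻ w, k w * (c ^ p * ∫⁻ x in Metric.ball y R, h (x + w) ^ p) := by
          rw [lintegral_const_mul' _ _ hA, lintegral_lintegral_swap hm.aemeasurable]
          rw [mul_left_comm, ← lintegral_const_mul' _ _ hcp]
          congr 1
          refine lintegral_congr fun w => ?_
          rw [lintegral_const_mul _ (by fun_prop)]
          ring
      _ ≤ A * ∫⁻ w, k w * M ^ p := by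
          gcongr with w
          exact hball w
      _ = _ := by
          rw [lintegral_mul_const _ hk, mul_assoc]
  have := ENNReal.rpow_le_rpow key (by positivity : 0 ≤ 1 / p)
  rwa [ENNReal.mul_rpow_of_nonneg _ _ (by positivity), ENNReal.mul_rpow_of_nonneg _ (M ^ p)
    (by positivity), ← ENNReal.rpow_mul c, ← ENNReal.rpow_mul M, mul_one_div_cancel hp.ne',
    ENNReal.rpow_one, ENNReal.rpow_one] at this

end Morrey

/-! ### Band-limited functions -/

section BandLimited

variable {d : ℕ}

local notation "E" => EuclideanSpace ℝ (Fin d)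

/-- Fourier inversion bounds `H` by the `L¹` norm of `𝓕 H`, which lives on a ball and is at most the
`L¹` norm of `H`. -/
theorem enorm_le_of_fourier_eq_zero {H : E → ℂ} (hc : Continuous H) (hi : Integrable H) {ρ : ℝ}
    (h0 : ∀ ξ, ρ < ‖ξ‖ → 𝓕 H ξ = 0) (z : E) :
    ‖H z‖ₑ ≤ volume (Metric.closedBall (0 : E) ρ) * ∫⁻ y, ‖H y‖ₑ := by
  have hFc : Continuous (𝓕 H) :=
    VectorFourier.fourierIntegral_continuous Real.continuous_fourierChar
      continuous_inner hi
  have hsupp : HasCompactSupport (𝓕 H) := by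
    refine HasCompactSupport.of_support_subset_isCompact (isCompact_closedBall (0 : E) ρ) ?_
    intro ξ hξ
    by_contra hn
    exact hξ (h0 ξ (by simpa using hn))
  have hFi : Integrable (𝓕 H) := hFc.integrable_of_hasCompactSupport hsupp
  have hbound (ξ : E) : ‖𝓕 H ξ‖ₑ ≤ ∫⁻ y, ‖H y‖ₑ := by
    rw [Real.fourier_eq]
    refine (enorm_integral_le_lintegral_enorm _).trans (le_of_eq (lintegral_congr fun y => ?_))
    rw [← ofReal_norm, ← ofReal_norm, Circle.norm_smul]
  rw [← congrFun (hc.fourierInv_fourier_eq hi hFi) z, Real.fourierInv_eq]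
  calc ‖∫ ξ, _‖ₑ ≤ ∫⁻ ξ, ‖𝓕 H ξ‖ₑ := by
        refine (enorm_integral_le_lintegral_enorm _).trans (le_of_eq (lintegral_congr fun y => ?_))
        rw [← ofReal_norm, ← ofReal_norm, Circle.norm_smul]
    _ ≤ ∫⁻ ξ, (Metric.closedBall (0 : E) ρ).indicator (fun _ => ∫⁻ y, ‖H y‖ₑ) ξ := by
        refine lintegral_mono fun ξ => ?_
        by_cases hξ : ξ ∈ Metric.closedBall (0 : E) ρ
        · rw [Set.indicator_of_mem hξ]; exact hbound ξ
        · rw [h0 ξ (by simpa using hξ)]; simp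
    _ = _ := by
        rw [lintegral_indicator_const measurableSet_closedBall, mul_comm]

open Real in
theorem fourier_compSubConst (θ : 𝓢(E, ℂ)) (x ξ : E) :
    𝓕 (θ.compSubConstCLM ℂ x) ξ = 𝐞 (-inner ℝ x ξ) • 𝓕 θ ξ := by
  rw [SchwartzMap.fourier_coe, SchwartzMap.fourier_coe, Real.fourier_eq, Real.fourier_eq,
    ← integral_add_right_eq_self _ x, Circle.smul_def, ← integral_smul]
  refine integral_congr_ae (Filter.Eventually.of_forall fun y => ?_)
  simp only [SchwartzMap.compSubConstCLM_apply, add_sub_cancel_right]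
  rw [← Circle.smul_def, smul_smul, ← AddChar.map_add_eq_mul, inner_add_left, neg_add_rev]

open Real in
theorem fourierInv_compSubConst (θ : 𝓢(E, ℂ)) (x ξ : E) :
    𝓕⁻ (θ.compSubConstCLM ℂ x) ξ = 𝐞 (inner ℝ x ξ) • 𝓕⁻ θ ξ := by
  rw [SchwartzMap.fourierInv_coe, SchwartzMap.fourierInv_coe, Real.fourierInv_eq_fourier_neg,
    Real.fourierInv_eq_fourier_neg, ← SchwartzMap.fourier_coe, ← SchwartzMap.fourier_coe,
    fourier_compSubConst, inner_neg_right, neg_neg]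

/-- A block of a block is a convolution with the block. -/
theorem blockFun_eq_integral {η φ : 𝓢(E, ℂ)} (h : ∀ ξ, φ ξ * η ξ = η ξ) (f : 𝓢'(E, ℂ)) (x : E) :
    Integrable (fun y => 𝓕 η (y - x) * blockFun φ f y) ∧
      blockFun η f x = ∫ y, 𝓕 η (y - x) * blockFun φ f y := by
  obtain ⟨h₁, h₂⟩ := (isInducedBy_blockFun φ f).2 ((𝓕 η : 𝓢(E, ℂ)).compSubConstCLM ℂ x)
  refine ⟨h₁, Eq.trans ?_ h₂⟩
  rw [TemperedDistribution.fourierInv_apply, TemperedDistribution.smulLeftCLM_apply_apply,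
    TemperedDistribution.fourier_apply]
  unfold blockFun
  congr 1
  -- The inverse transform of a translate of `𝓕 η` is `η` times a character, so `φ` reproduces it.
  have : SchwartzMap.smulLeftCLM ℂ φ (𝓕⁻ ((𝓕 η : 𝓢(E, ℂ)).compSubConstCLM ℂ x))
      = 𝓕⁻ ((𝓕 η : 𝓢(E, ℂ)).compSubConstCLM ℂ x) := by
    ext ξ
    rw [SchwartzMap.smulLeftCLM_apply_apply φ.hasTemperateGrowth, fourierInv_compSubConst,
      FourierTransform.fourierInv_fourier_eq, smul_eq_mul, Circle.smul_def, smul_eq_mul,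
      mul_left_comm, h]
  rw [this, FourierTransform.fourier_fourierInv_eq]

/-- The spectrum of a product lies in the sum of the two spectra. Concretely, `v` is a modulation of
`η` shifted by `ζ`, and for `‖ζ‖ > 2b` it vanishes wherever `φ` does not. -/
theorem fourier_kernel_mul_blockFun_eq_zero {η φ : 𝓢(E, ℂ)} {b : ℝ}
    (hη : ∀ ξ, b < ‖ξ‖ → η ξ = 0) (hφ : ∀ ξ, b < ‖ξ‖ → φ ξ = 0) (f : 𝓢'(E, ℂ)) (x : E) {ζ : E}
    (hζ : 2 * b < ‖ζ‖) : 𝓕 (fun y => 𝓕 η (y - x) * blockFun φ f y) ζ = 0 := by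
  set v : 𝓢(E, ℂ) := (𝓕⁻ ((𝓕 η : 𝓢(E, ℂ)).compSubConstCLM ℂ x)).compSubConstCLM ℂ ζ with hv
  have h₂ := ((isInducedBy_blockFun φ f).2 (𝓕 v)).2
  have hv' (ξ : E) : φ ξ * v ξ = 0 := by
    rw [hv, SchwartzMap.compSubConstCLM_apply, fourierInv_compSubConst,
      FourierTransform.fourierInv_fourier_eq]
    rcases lt_or_ge b ‖ξ‖ with hξ | hξ
    · rw [hφ ξ hξ, zero_mul]
    · rw [hη (ξ - ζ), smul_zero, mul_zero]
      have := norm_sub_norm_le ζ ξ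
      rw [norm_sub_rev] at this
      linarith
  have h0 : SchwartzMap.smulLeftCLM ℂ φ v = 0 := by
    ext ξ
    rw [SchwartzMap.smulLeftCLM_apply_apply φ.hasTemperateGrowth]
    exact hv' ξ
  rw [TemperedDistribution.fourierInv_apply, TemperedDistribution.smulLeftCLM_apply_apply,
    TemperedDistribution.fourier_apply, FourierTransform.fourierInv_fourier_eq, h0,
    FourierTransform.fourier_zero, map_zero] at h₂
  rw [h₂, Real.fourier_eq]
  refine integral_congr_ae (Filter.Eventually.of_forall fun y => ?_)
  simp only [hv, fourier_compSubConst, FourierTransform.fourier_fourierInv_eq,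
    SchwartzMap.compSubConstCLM_apply, Circle.smul_def, smul_eq_mul, real_inner_comm]
  ring

end BandLimited

/-! ### Fourier multipliers and the size of their kernels -/

section Multiplier

variable {d : ℕ}

local notation "E" => EuclideanSpace ℝ (Fin d)

/-- The Fourier multiplier theorem for band-limited functions in Morrey spaces. -/
theorem exists_morreyNorm_blockFun_le (d : ℕ) (u b : ℝ) {p : ℝ} (hp : 0 < p) :
    ∃ C : ℝ≥0∞, C ≠ ⊤ ∧ ∀ (φ η : 𝓢(EuclideanSpace ℝ (Fin d), ℂ)), (∀ ξ, b < ‖ξ‖ → φ ξ = 0) →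
      (∀ ξ, b < ‖ξ‖ → η ξ = 0) → (∀ ξ, φ ξ * η ξ = η ξ) →
      ∀ f : 𝓢'(EuclideanSpace ℝ (Fin d), ℂ),
        morreyNorm u p (fun x => ‖blockFun η f x‖ₑ) ≤
          C * (∫⁻ w, ‖𝓕 η w‖ₑ ^ min 1 p) ^ (1 / min 1 p) *
            morreyNorm u p (fun x => ‖blockFun φ f x‖ₑ) := by
  have hmeas (φ : 𝓢(EuclideanSpace ℝ (Fin d), ℂ)) (f : 𝓢'(EuclideanSpace ℝ (Fin d), ℂ)) :
      Measurable fun x => ‖blockFun φ f x‖ₑ := (isInducedBy_blockFun φ f).1.measurable.enorm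
  have hint (φ η : 𝓢(EuclideanSpace ℝ (Fin d), ℂ)) (f : 𝓢'(EuclideanSpace ℝ (Fin d), ℂ))
      (x : EuclideanSpace ℝ (Fin d)) (t : ℝ) :
      ∫⁻ y, ‖𝓕 η (y - x) * blockFun φ f y‖ₑ ^ t =
        ∫⁻ w, (‖𝓕 η w‖ₑ * ‖blockFun φ f (x + w)‖ₑ) ^ t := by
    rw [← lintegral_add_left_eq_self _ x]
    simp only [add_sub_cancel_left, enorm_mul]
  have hle {φ η : 𝓢(EuclideanSpace ℝ (Fin d), ℂ)} (h : ∀ ξ, φ ξ * η ξ = η ξ)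
      (f : 𝓢'(EuclideanSpace ℝ (Fin d), ℂ)) (x : EuclideanSpace ℝ (Fin d)) :
      ‖blockFun η f x‖ₑ ≤ ∫⁻ y, ‖𝓕 η (y - x) * blockFun φ f y‖ₑ := by
    rw [(blockFun_eq_integral h f x).2]
    exact enorm_integral_le_lintegral_enorm _
  -- For `p ≤ 1` the reverse Hölder inequality moves the power inside the integral, at the cost of a
  -- power of the volume of the ball of radius `2b`; for `p ≥ 1` Jensen's inequality does so. The
  -- constant is independent of `η`.
  rcases le_total p 1 with hp1 | hp1
  · set V := volume (Metric.closedBall (0 : EuclideanSpace ℝ (Fin d)) (2 * b)) with hV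
    have hVtop : V ≠ ⊤ := measure_closedBall_lt_top.ne
    have hA : V ^ (1 - p) ≠ ⊤ := ENNReal.rpow_ne_top_of_nonneg (by linarith) hVtop
    refine ⟨(V ^ (1 - p)) ^ (1 / p), ENNReal.rpow_ne_top_of_nonneg (by positivity) hA,
      fun φ η hφ hη h f => ?_⟩
    rw [min_eq_right hp1, ← ENNReal.mul_rpow_of_nonneg _ _ (by positivity)]
    refine morreyNorm_le_of_rpow_le hp (hmeas φ f) (by fun_prop) hA fun x => ?_
    have hH := (blockFun_eq_integral h f x).1
    have hcont : Continuous fun y => 𝓕 η (y - x) * blockFun φ f y :=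
      ((𝓕 η : 𝓢(EuclideanSpace ℝ (Fin d), ℂ)).continuous.comp (continuous_sub_right x)).mul
        (isInducedBy_blockFun φ f).1
    have := lintegral_rpow_le_of_le_mul_lintegral (μ := volume) hVtop hH.2.ne
      (enorm_le_of_fourier_eq_zero hcont hH fun ζ hζ =>
        fourier_kernel_mul_blockFun_eq_zero hη hφ f x hζ) hp hp1
    refine (ENNReal.rpow_le_rpow (hle h f x) hp.le).trans (this.trans_eq ?_)
    simp only [hint, ENNReal.mul_rpow_of_nonneg _ _ hp.le]
  · refine ⟨1, ENNReal.one_ne_top, fun φ η _ _ h f => ?_⟩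
    simp only [min_eq_left hp1, div_one, ENNReal.rpow_one, one_mul]
    have hk : Measurable fun w => ‖𝓕 η w‖ₑ := (𝓕 η).continuous.measurable.enorm
    have hkfin : ∫⁻ w, ‖𝓕 η w‖ₑ ≠ ⊤ := (𝓕 η).integrable.2.ne
    have hA : (∫⁻ w, ‖𝓕 η w‖ₑ) ^ (p - 1) ≠ ⊤ :=
      ENNReal.rpow_ne_top_of_nonneg (by linarith) hkfin
    have e : ∫⁻ w, ‖𝓕 η w‖ₑ = ((∫⁻ w, ‖𝓕 η w‖ₑ) ^ (p - 1) * ∫⁻ w, ‖𝓕 η w‖ₑ) ^ (1 / p) := by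
      nth_rewrite 3 [← ENNReal.rpow_one (∫⁻ w, ‖𝓕 η w‖ₑ)]
      rw [← ENNReal.rpow_add_of_nonneg _ _ (by linarith) zero_le_one, sub_add_cancel,
        ← ENNReal.rpow_mul, mul_one_div_cancel hp.ne', ENNReal.rpow_one]
    rw [e]
    refine morreyNorm_le_of_rpow_le hp (hmeas φ f) hk hA fun x => ?_
    refine (ENNReal.rpow_le_rpow (hle h f x) hp.le).trans ?_
    have := hint φ η f x 1
    simp only [ENNReal.rpow_one] at this
    rw [this]
    exact lintegral_mul_rpow_le hk ((hmeas φ f).comp (measurable_const_add x)) hp1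

theorem fourier_apply_of_dilation {η η' : 𝓢(E, ℂ)} {t : ℝ} (ht : 0 < t)
    (h : ∀ ξ, η' ξ = η (t • ξ)) (y : E) : 𝓕 η' y = (t ^ d)⁻¹ • 𝓕 η (t⁻¹ • y) := by
  rw [SchwartzMap.fourier_coe, SchwartzMap.fourier_coe, Real.fourier_eq, Real.fourier_eq]
  have := Measure.integral_comp_smul volume
    (fun ξ : E => Real.fourierChar (-inner ℝ ξ (t⁻¹ • y)) • η ξ) t
  rw [finrank_euclideanSpace_fin, abs_of_pos (by positivity)] at this
  rw [← this]
  refine integral_congr_ae (Filter.Eventually.of_forall fun ξ => ?_)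
  simp only [h, inner_smul_left, inner_smul_right]
  congr 3
  simp
  field_simp

theorem lintegral_comp_smul_inv (k : E → ℝ≥0∞) (hk : Measurable k) {t : ℝ} (ht : 0 < t) :
    ∫⁻ y, k (t⁻¹ • y) = ENNReal.ofReal (t ^ d) * ∫⁻ y, k y := by
  have h := Measure.map_addHaar_smul (volume : Measure E) (inv_ne_zero ht.ne')
  rw [← lintegral_map hk (measurable_const_smul t⁻¹), h, lintegral_smul_measure,
    finrank_euclideanSpace_fin, inv_pow, inv_inv, abs_of_pos (by positivity), smul_eq_mul]

/-- The `L^r` norm of the kernel of a dilated multiplier. -/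
theorem kernel_norm_of_dilation {η η' : 𝓢(E, ℂ)} {t : ℝ} (ht : 0 < t)
    (h : ∀ ξ, η' ξ = η (t • ξ)) {r : ℝ} (hr : 0 < r) :
    (∫⁻ w, ‖𝓕 η' w‖ₑ ^ r) ^ (1 / r) =
      ENNReal.ofReal (t ^ (d * (1 / r - 1))) * (∫⁻ w, ‖𝓕 η w‖ₑ ^ r) ^ (1 / r) := by
  have e (w : E) : ‖𝓕 η' w‖ₑ ^ r
      = ENNReal.ofReal ((t ^ d)⁻¹ ^ r) * ‖𝓕 η (t⁻¹ • w)‖ₑ ^ r := by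
    rw [fourier_apply_of_dilation ht h, enorm_smul, ENNReal.mul_rpow_of_nonneg _ _ hr.le,
      Real.enorm_of_nonneg (by positivity), ENNReal.ofReal_rpow_of_nonneg (by positivity) hr.le]
  simp only [e]
  rw [lintegral_const_mul' _ _ ENNReal.ofReal_ne_top,
    lintegral_comp_smul_inv (fun w => ‖𝓕 η w‖ₑ ^ r)
      ((𝓕 η).continuous.measurable.enorm.pow_const r) ht, ← mul_assoc,
    ← ENNReal.ofReal_mul (by positivity), ENNReal.mul_rpow_of_nonneg _ _ (by positivity),
    ENNReal.ofReal_rpow_of_nonneg (by positivity) (by positivity)]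
  -- The exponent `d(1/r - 1)` combines `t^{-d}` from the amplitude with `t^{d/r}` from the change
  -- of variables.
  congr 2
  rw [← Real.rpow_natCast, ← Real.rpow_neg ht.le, ← Real.rpow_mul ht.le, ← Real.rpow_add ht,
    ← Real.rpow_mul ht.le]
  congr 1
  field_simp
  ring

/-- Schwartz functions lie in every `L^r`, including `r < 1`. -/
theorem kernel_norm_ne_top (η : 𝓢(E, ℂ)) {r : ℝ} (hr : 0 < r) :
    (∫⁻ w, ‖𝓕 η w‖ₑ ^ r) ^ (1 / r) ≠ ⊤ := by
  refine ENNReal.rpow_ne_top_of_nonneg (by positivity) ?_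
  have h : eLpNorm (𝓕 η : 𝓢(E, ℂ)) (ENNReal.ofReal r) volume < ⊤ :=
    SchwartzMap.eLpNorm_lt_top (𝓕 η) (ENNReal.ofReal r) volume
  have := lintegral_rpow_enorm_lt_top_of_eLpNorm_lt_top (ENNReal.ofReal_pos.2 hr).ne'
    ENNReal.ofReal_ne_top h
  rw [ENNReal.toReal_ofReal hr.le] at this
  exact this.ne

end Multiplier

/-! ### Powers of two -/

theorem twoPow_zero : twoPow 0 = 1 := by simp [twoPow]

theorem twoPow_ne_top (t : ℝ) : twoPow t ≠ ⊤ := ENNReal.ofReal_ne_top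

theorem twoPow_add (s t : ℝ) : twoPow (s + t) = twoPow s * twoPow t := by
  rw [twoPow, twoPow, twoPow, ← ENNReal.ofReal_mul (by positivity), Real.rpow_add two_pos]

theorem twoPow_rpow (t : ℝ) {r : ℝ} (hr : 0 ≤ r) : twoPow t ^ r = twoPow (t * r) := by
  rw [twoPow, twoPow, ENNReal.ofReal_rpow_of_nonneg (by positivity) hr, Real.rpow_mul two_pos.le]

theorem tsum_twoPow_ne_top {t : ℝ} (ht : t < 0) : ∑' k : ℕ, twoPow (k * t) ≠ ⊤ := by
  have e (k : ℕ) : twoPow (k * t) = twoPow t ^ k := by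
    rw [← ENNReal.rpow_natCast, twoPow_rpow _ (by positivity), mul_comm]
  have h1 : twoPow t < 1 := by
    rw [twoPow, ← ENNReal.ofReal_one]
    exact (ENNReal.ofReal_lt_ofReal_iff one_pos).2 (Real.rpow_lt_one_of_one_lt_of_neg one_lt_two ht)
  simp only [e, ENNReal.tsum_geometric]
  exact ENNReal.inv_ne_top.2 (tsub_pos_of_lt h1).ne'

/-! ### Blocks of test functions -/

section Blocks

variable {d : ℕ}

local notation "E" => EuclideanSpace ℝ (Fin d)

/-- Smooth functions with compact support. -/
structure IsTest (η : E → ℝ) : Prop where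
  smooth : ContDiff ℝ ∞ η
  compact : HasCompactSupport η

theorem IsTest.dilate {η : E → ℝ} (h : IsTest η) {t : ℝ} (ht : t ≠ 0) : IsTest (dilate t η) :=
  ⟨h.smooth.comp (contDiff_const_smul t), h.compact.comp_smul ht⟩

theorem IsTest.sub {η θ : E → ℝ} (h : IsTest η) (h' : IsTest θ) : IsTest fun x => η x - θ x :=
  ⟨h.smooth.sub h'.smooth, h.compact.sub h'.compact⟩

theorem IsCutoff.isTest {a b : ℝ} {φ₀ : E → ℝ} (h : IsCutoff a b φ₀) : IsTest φ₀ := by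
  refine ⟨h.smooth, HasCompactSupport.of_support_subset_isCompact
    (isCompact_closedBall (0 : E) b) fun ξ hξ => ?_⟩
  by_contra hn
  rw [mem_closedBall_zero_iff, not_le] at hn
  exact hξ (h.eq_zero ξ hn.le)

theorem IsTest.psi {φ₀ : E → ℝ} (h : IsTest φ₀) : IsTest (psi φ₀) :=
  h.sub (h.dilate two_ne_zero)

theorem IsTest.psiDyadic {φ₀ : E → ℝ} (h : IsTest φ₀) (k : ℤ) : IsTest (psiDyadic φ₀ k) :=
  h.psi.dilate (by positivity)

/-- A test function as a Schwartz function. -/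
noncomputable def IsTest.toSchwartz {η : E → ℝ} (h : IsTest η) : 𝓢(E, ℂ) :=
  HasCompactSupport.toSchwartzMap (f := fun ξ => (η ξ : ℂ)) 
    (h.compact.comp_left (g := ((↑) : ℝ → ℂ)) Complex.ofReal_zero)
    (by have := h.smooth; exact (Complex.ofRealCLM.contDiff (n := ∞)).comp this)

theorem IsTest.toSchwartz_apply {η : E → ℝ} (h : IsTest η) (ξ : E) :
    h.toSchwartz ξ = (η ξ : ℂ) := rfl

theorem absBlock_apply {η : E → ℝ} (h : IsTest η) (f : 𝓢'(E, ℂ)) (x : E) :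
    absBlock η f x = ‖blockFun h.toSchwartz f x‖ₑ := by
  unfold absBlock
  rw [← (isInducedBy_blockFun h.toSchwartz f).toFunction_eq]
  rfl

theorem measurable_absBlock {η : E → ℝ} (h : IsTest η) (f : 𝓢'(E, ℂ)) :
    Measurable (absBlock η f) := by
  rw [funext (absBlock_apply h f)]
  exact (isInducedBy_blockFun h.toSchwartz f).1.measurable.enorm

theorem blockFun_eq_add {η θ ζ : E → ℝ} (hη : IsTest η) (hθ : IsTest θ) (hζ : IsTest ζ)
    (h : ∀ x, η x = θ x + ζ x) (f : 𝓢'(E, ℂ)) (x : E) :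
    blockFun hη.toSchwartz f x = blockFun hθ.toSchwartz f x + blockFun hζ.toSchwartz f x := by
  have e : hη.toSchwartz = hθ.toSchwartz + hζ.toSchwartz := by
    ext ξ
    simp [IsTest.toSchwartz_apply, h]
  unfold blockFun
  rw [e, FourierTransform.fourier_add, map_add, map_add]

theorem absBlock_le_add {η θ ζ : E → ℝ} (hη : IsTest η) (hθ : IsTest θ) (hζ : IsTest ζ)
    (h : ∀ x, η x = θ x + ζ x) (f : 𝓢'(E, ℂ)) (x : E) :
    absBlock η f x ≤ absBlock θ f x + absBlock ζ f x := by
  rw [absBlock_apply hη, absBlock_apply hθ, absBlock_apply hζ, blockFun_eq_add hη hθ hζ h]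
  exact enorm_add_le _ _

theorem absBlock_le_add_of_sub {η θ ζ : E → ℝ} (hη : IsTest η) (hθ : IsTest θ) (hζ : IsTest ζ)
    (h : ∀ x, η x = θ x - ζ x) (f : 𝓢'(E, ℂ)) (x : E) :
    absBlock η f x ≤ absBlock θ f x + absBlock ζ f x := by
  rw [absBlock_apply hη, absBlock_apply hθ, absBlock_apply hζ,
    eq_sub_of_add_eq (blockFun_eq_add hθ hη hζ (fun y => by rw [h, sub_add_cancel]) f x).symm]
  exact enorm_sub_le

/-! ### Low-frequency blocks -/

theorem psiDyadic_neg_natCast (φ₀ : E → ℝ) (k : ℕ) :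
    psiDyadic φ₀ (-(k : ℤ)) = dilate ((2 : ℝ) ^ k) (psi φ₀) := by
  simp [psiDyadic]

theorem psiDyadic_neg_natCast_apply (φ₀ : E → ℝ) (k : ℕ) (x : E) :
    psiDyadic φ₀ (-(k : ℤ)) x
      = dilate ((2 : ℝ) ^ k) φ₀ x - dilate ((2 : ℝ) ^ (k + 1)) φ₀ x := by
  rw [psiDyadic_neg_natCast]
  simp [dilate, psi, smul_smul, pow_succ']

theorem dilate_eq_zero {a b : ℝ} {φ₀ : E → ℝ} (h : IsCutoff a b φ₀) {t : ℝ} (ht : 0 < t) {ξ : E}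
    (hξ : b ≤ t * ‖ξ‖) : dilate t φ₀ ξ = 0 :=
  h.eq_zero _ (by rwa [norm_smul, Real.norm_of_nonneg ht.le])

/-- Where `‖ξ‖ > a ≥ 1`, one has `t‖ξ‖ ≥ 2 ≥ b`, so the dilate vanishes outside the region where `φ₀
= 1`. -/
theorem mul_dilate {a b : ℝ} (ha : 1 ≤ a) (hb : b ≤ 2) {φ₀ : E → ℝ} (h : IsCutoff a b φ₀) {t : ℝ}
    (ht : 2 ≤ t) (ξ : E) : φ₀ ξ * dilate t φ₀ ξ = dilate t φ₀ ξ := by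
  rcases le_or_gt ‖ξ‖ a with hξ | hξ
  · rw [h.eq_one ξ hξ, one_mul]
  · rw [dilate_eq_zero h (by linarith) (by nlinarith), mul_zero]

/-- Multipliers that `φ₀` reproduces act boundedly on the low-frequency part. -/
theorem exists_morreyNorm_absBlock_le {a b : ℝ} {φ₀ : E → ℝ}
    (h : IsCutoff a b φ₀) (u : ℝ) {p : ℝ} (hp : 0 < p) :
    ∃ C : ℝ≥0∞, C ≠ ⊤ ∧ ∀ (η : E → ℝ) (hη : IsTest η), (∀ ξ, b < ‖ξ‖ → η ξ = 0) →
      (∀ ξ, φ₀ ξ * η ξ = η ξ) → ∀ f : 𝓢'(E, ℂ),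
        morreyNorm u p (absBlock η f) ≤
          C * (∫⁻ w, ‖𝓕 hη.toSchwartz w‖ₑ ^ min 1 p) ^ (1 / min 1 p) *
            morreyNorm u p (absBlock φ₀ f) := by
  obtain ⟨C, hC, hmul⟩ := exists_morreyNorm_blockFun_le d u b hp
  refine ⟨C, hC, fun η hη hs hr f => ?_⟩
  rw [funext (absBlock_apply hη f), funext (absBlock_apply h.isTest f)]
  refine hmul h.isTest.toSchwartz hη.toSchwartz (fun ξ hξ => ?_) (fun ξ hξ => ?_) (fun ξ => ?_) f
  · rw [IsTest.toSchwartz_apply, h.eq_zero ξ hξ.le, Complex.ofReal_zero]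
  · rw [IsTest.toSchwartz_apply, hs ξ hξ, Complex.ofReal_zero]
  · rw [IsTest.toSchwartz_apply, IsTest.toSchwartz_apply, ← Complex.ofReal_mul, hr]

theorem exists_morreyNorm_absBlock_dilate_le {a b : ℝ} (ha : 1 ≤ a) (hab : a < b) (hb : b ≤ 2)
    {φ₀ : E → ℝ} (h : IsCutoff a b φ₀) (u : ℝ) {p : ℝ} (hp : 0 < p) {t : ℝ} (ht : 2 ≤ t) :
    ∃ C : ℝ≥0∞, C ≠ ⊤ ∧ ∀ f : 𝓢'(E, ℂ),
      morreyNorm u p (absBlock (dilate t φ₀) f) ≤ C * morreyNorm u p (absBlock φ₀ f) := by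
  obtain ⟨C, hC, hmul⟩ := exists_morreyNorm_absBlock_le h u hp
  have ht0 : 0 < t := by linarith
  have hη : IsTest (dilate t φ₀) := h.isTest.dilate ht0.ne'
  exact ⟨_, ENNReal.mul_ne_top hC (kernel_norm_ne_top hη.toSchwartz (lt_min one_pos hp)),
    hmul _ hη (fun ξ hξ => dilate_eq_zero h ht0 (by nlinarith)) (mul_dilate ha hb h ht)⟩

/-- The two alternatives serve two sources: sequence norms split only after taking `r`-th powers,
whereas blocks obey the triangle inequality itself. -/
theorem morreyNorm_add_rpow_le {u p : ℝ} (hp : 0 < p) {r : ℝ} (hr : 0 < r) (hr1 : r ≤ 1)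
    (hrp : r ≤ p) {F g h : E → ℝ≥0∞} (hg : Measurable g) (hh : Measurable h)
    (hF : ∀ x, F x ^ r ≤ g x ^ r + h x ^ r ∨ F x ≤ g x + h x) :
    morreyNorm u p F ^ r ≤ morreyNorm u p g ^ r + morreyNorm u p h ^ r := by
  have := morreyNorm_rpow_le_tsum (u := u) hp (ι := Bool) hr hrp (F := F)
    (g := fun i => bif i then g else h) (by rintro (_ | _) <;> simpa) fun x => by
      rw [tsum_bool, add_comm]
      rcases hF x with hF | hF
      · exact hF
      · exact (ENNReal.rpow_le_rpow hF hr.le).trans (ENNReal.rpow_add_le_add_rpow _ _ hr.le hr1)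
  rw [tsum_bool, add_comm] at this
  exact this

theorem le_mul_of_rpow_le {r : ℝ} (hr : 0 < r) {x y D : ℝ≥0∞} (h : x ^ r ≤ D * y ^ r) :
    x ≤ D ^ (1 / r) * y := by
  have := ENNReal.rpow_le_rpow h (by positivity : 0 ≤ 1 / r)
  rwa [ENNReal.mul_rpow_of_nonneg _ _ (by positivity), ← ENNReal.rpow_mul, ← ENNReal.rpow_mul,
    mul_one_div_cancel hr.ne', ENNReal.rpow_one, ENNReal.rpow_one] at this

/-- The blocks of frequency `2^{-k}` are controlled by the low-frequency part, with a constant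
that grows at most like `2^{k σ_p}`. -/
theorem exists_morreyNorm_absBlock_psiDyadic_le {a b : ℝ} (ha : 1 ≤ a) (hab : a < b) (hb : b ≤ 2)
    {φ₀ : E → ℝ} (h : IsCutoff a b φ₀) (u : ℝ) {p : ℝ} (hp : 0 < p) :
    ∃ C : ℝ≥0∞, C ≠ ⊤ ∧ ∀ (k : ℕ) (f : 𝓢'(E, ℂ)),
      morreyNorm u p (absBlock (psiDyadic φ₀ (-(k : ℤ))) f) ≤
        C * twoPow (k * sigma d p) * morreyNorm u p (absBlock φ₀ f) := by
  obtain ⟨C, hC, hmul⟩ := exists_morreyNorm_absBlock_le h u hp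
  obtain ⟨A, hA, hdil⟩ := exists_morreyNorm_absBlock_dilate_le ha hab hb h u hp le_rfl
  have hr : 0 < min 1 p := lt_min one_pos hp
  set B := (∫⁻ w, ‖𝓕 h.isTest.psi.toSchwartz w‖ₑ ^ min 1 p) ^ (1 / min 1 p) with hB
  have hBtop : B ≠ ⊤ := kernel_norm_ne_top _ hr
  have hσ : (d : ℝ) * (1 / min 1 p - 1) = sigma d p := by
    unfold sigma
    congr 1
    rcases le_total p 1 with hp1 | hp1
    · rw [min_eq_right hp1, max_eq_right]
      rw [sub_nonneg, one_le_div hp]; exact hp1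
    · rw [min_eq_left hp1, max_eq_left]
      · simp
      · rw [sub_nonpos, div_le_one hp]; exact hp1
  set D := (1 + A ^ min 1 p) ^ (1 / min 1 p) with hD
  have hDtop : D ≠ ⊤ := ENNReal.rpow_ne_top_of_nonneg (by positivity)
    (ENNReal.add_ne_top.2 ⟨ENNReal.one_ne_top, ENNReal.rpow_ne_top_of_nonneg hr.le hA⟩)
  refine ⟨D + C * B, ENNReal.add_ne_top.2 ⟨hDtop, ENNReal.mul_ne_top hC hBtop⟩, fun k f => ?_⟩
  -- The index `0` is separate: `ψ_0` may be nonzero where `φ₀` is not `1`, so the reproducing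
  -- argument is replaced by `ψ_0 = φ₀ - D_2 φ₀`.
  rcases Nat.eq_zero_or_pos k with rfl | hk
  · rw [Nat.cast_zero (R := ℝ), zero_mul, twoPow_zero, mul_one]
    have h₁ : morreyNorm u p (absBlock (psiDyadic φ₀ (-((0 : ℕ) : ℤ))) f) ^ min 1 p ≤
        morreyNorm u p (absBlock φ₀ f) ^ min 1 p +
          morreyNorm u p (absBlock (dilate 2 φ₀) f) ^ min 1 p := by
      refine morreyNorm_add_rpow_le hp hr (min_le_left _ _) (min_le_right _ _)
        (measurable_absBlock h.isTest f)
        (measurable_absBlock (h.isTest.dilate two_ne_zero) f) fun x => Or.inr ?_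
      refine absBlock_le_add_of_sub (h.isTest.psiDyadic _) h.isTest
        (h.isTest.dilate two_ne_zero) (fun x => ?_) f x
      rw [psiDyadic_neg_natCast_apply]
      simp [dilate]
    refine (le_mul_of_rpow_le hr (h₁.trans ?_)).trans
      (mul_le_mul_left (le_self_add : D ≤ D + C * B) _)
    rw [add_mul, one_mul, ← ENNReal.mul_rpow_of_nonneg _ _ hr.le]
    gcongr
    exact hdil f
  · have ht : (2 : ℝ) ≤ 2 ^ k := by
      simpa using pow_le_pow_right₀ (one_le_two (α := ℝ)) hk
    have ht' : (2 : ℝ) ≤ 2 ^ (k + 1) := by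
      simpa using pow_le_pow_right₀ (one_le_two (α := ℝ)) (Nat.le_add_left 1 k)
    have hη := h.isTest.psiDyadic (-(k : ℤ))
    have hbξ (ξ : E) (hξ : b < ‖ξ‖) : psiDyadic φ₀ (-(k : ℤ)) ξ = 0 := by
      rw [psiDyadic_neg_natCast_apply, dilate_eq_zero h (by linarith) (by nlinarith),
        dilate_eq_zero h (by linarith) (by nlinarith), sub_zero]
    have hrep (ξ : E) : φ₀ ξ * psiDyadic φ₀ (-(k : ℤ)) ξ = psiDyadic φ₀ (-(k : ℤ)) ξ := by
      rw [psiDyadic_neg_natCast_apply, mul_sub, mul_dilate ha hb h ht, mul_dilate ha hb h ht']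
    refine (hmul _ hη hbξ hrep f).trans ?_
    have hkern := kernel_norm_of_dilation (η := h.isTest.psi.toSchwartz) (η' := hη.toSchwartz)
      (t := 2 ^ k) (by positivity) (fun ξ => by
        rw [IsTest.toSchwartz_apply, IsTest.toSchwartz_apply, psiDyadic_neg_natCast]; rfl) hr
    have htp : ENNReal.ofReal (((2 : ℝ) ^ k) ^ ((d : ℝ) * (1 / min 1 p - 1)))
        = twoPow (k * sigma d p) := by
      rw [hσ, twoPow, ← Real.rpow_natCast, ← Real.rpow_mul two_pos.le]
    rw [hkern, htp, ← hB]
    calc _ = C * B * twoPow (k * sigma d p) * morreyNorm u p (absBlock φ₀ f) := by ring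
      _ ≤ _ := by gcongr; exact le_add_self

end Blocks

/-! ### Equivalence of functionals -/

theorem Equivalent.of_le {X : Type*} {N₁ N₂ : X → ℝ≥0∞} {A B : ℝ≥0∞} (hA : A ≠ ⊤) (hB : B ≠ ⊤)
    (h₁ : ∀ f, N₁ f ≤ A * N₂ f) (h₂ : ∀ f, N₂ f ≤ B * N₁ f) : Equivalent N₁ N₂ := by
  -- The summand `1` makes the common constant positive.
  refine ⟨A.toNNReal + B.toNNReal + 1, by positivity, fun f => ⟨(h₁ f).trans ?_, (h₂ f).trans ?_⟩⟩
  all_goals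
    push_cast
    rw [ENNReal.coe_toNNReal hA, ENNReal.coe_toNNReal hB]
    gcongr
  · rw [add_assoc]; exact le_self_add
  · rw [add_right_comm]; exact le_add_self

theorem Equivalent.symm {X : Type*} {N₁ N₂ : X → ℝ≥0∞} (h : Equivalent N₁ N₂) :
    Equivalent N₂ N₁ := by
  obtain ⟨C, hC, h⟩ := h
  exact ⟨C, hC, fun f => (h f).symm⟩

theorem Equivalent.trans {X : Type*} {N₁ N₂ N₃ : X → ℝ≥0∞} (h : Equivalent N₁ N₂)
    (h' : Equivalent N₂ N₃) : Equivalent N₁ N₃ := by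
  obtain ⟨C, -, h⟩ := h
  obtain ⟨C', -, h'⟩ := h'
  have hC : (C * C' : ℝ≥0∞) ≠ ⊤ := ENNReal.mul_ne_top ENNReal.coe_ne_top ENNReal.coe_ne_top
  refine .of_le hC hC (fun f => ?_) fun f => ?_
  · refine (h f).1.trans ?_
    rw [mul_assoc]
    gcongr
    exact (h' f).1
  · refine (h' f).2.trans ?_
    rw [mul_comm (C : ℝ≥0∞), mul_assoc]
    gcongr
    exact (h f).2

theorem exists_common_exponent {p : ℝ} (hp : 0 < p) {q : ℝ≥0∞} (hq : 0 < q) :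
    ∃ r : ℝ, 0 < r ∧ r ≤ 1 ∧ r ≤ p ∧ ENNReal.ofReal r ≤ q := by
  -- Since `(⊤ : ℝ≥0∞).toReal = 0`, the case `q = ∞` must leave `q` out of the minimum.
  rcases eq_or_ne q ⊤ with rfl | hq'
  · exact ⟨min 1 p, lt_min one_pos hp, min_le_left _ _, min_le_right _ _, le_top⟩
  · refine ⟨min (min 1 p) q.toReal, lt_min (lt_min one_pos hp) (ENNReal.toReal_pos hq.ne' hq'),
      (min_le_left _ _).trans (min_le_left _ _), (min_le_left _ _).trans (min_le_right _ _), ?_⟩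
    rw [ENNReal.ofReal_le_iff_le_toReal hq']
    exact min_le_right _ _

/-! ### Comparison of the quasi-norms -/

section Norms

variable {d : ℕ}

local notation "E" => EuclideanSpace ℝ (Fin d)

variable {φ₀ : EuclideanSpace ℝ (Fin d) → ℝ} {s u p : ℝ} {q : ℝ≥0∞}

theorem IsTest.phiDyadic (h : IsTest φ₀) (k : ℕ) : IsTest (phiDyadic φ₀ k) := by
  unfold TLM.phiDyadic
  split_ifs
  · exact h
  · exact h.psiDyadic _

theorem morreyNorm_absBlock_le_tlmNorm (hp : 0 < p) (hq : 0 < q) (f : 𝓢'(E, ℂ)) :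
    morreyNorm u p (absBlock φ₀ f) ≤ tlmNorm φ₀ s u p q f := by
  refine morreyNorm_mono hp fun x => ?_
  have := le_lqNorm hq (fun k : ℕ => twoPow ((k : ℝ) * s) * absBlock (phiDyadic φ₀ k) f x) 0
  simpa [phiDyadic, twoPow_zero] using this

theorem mul_morreyNorm_absBlock_le_blockNorm (hp : 0 < p) (hq : 0 < q) {K : WithTop ℤ} {k : ℤ}
    (hk : ((-k : ℤ) : WithTop ℤ) ≤ K) (f : 𝓢'(E, ℂ)) :
    twoPow (k * s) * morreyNorm u p (absBlock (psiDyadic φ₀ k) f) ≤ blockNorm φ₀ s u p q K f := by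
  rw [← morreyNorm_const_mul hp (twoPow_ne_top _)]
  refine morreyNorm_mono hp fun x => ?_
  exact le_lqNorm hq (fun k : {k : ℤ // ((-k : ℤ) : WithTop ℤ) ≤ K} =>
    twoPow ((k.1 : ℝ) * s) * absBlock (psiDyadic φ₀ k.1) f x) ⟨k, hk⟩

variable {r : ℝ}

theorem tlmNorm_rpow_le (h : IsTest φ₀) (hp : 0 < p) (hr : 0 < r) (hr1 : r ≤ 1) (hrp : r ≤ p)
    (hrq : ENNReal.ofReal r ≤ q) {K : WithTop ℤ} (hK : 0 ≤ K) (f : 𝓢'(E, ℂ)) :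
    tlmNorm φ₀ s u p q f ^ r ≤
      morreyNorm u p (absBlock φ₀ f) ^ r + blockNorm φ₀ s u p q K f ^ r := by
  refine morreyNorm_add_rpow_le hp hr hr1 hrp (measurable_absBlock h f)
    (measurable_lqNorm q fun k => (measurable_absBlock (h.psiDyadic _) f).const_mul _)
    fun x => Or.inl ?_
  have hidx (k : ℕ) : ((-(k : ℤ) : ℤ) : WithTop ℤ) ≤ K :=
    le_trans (by exact_mod_cast neg_nonpos.2 (Int.natCast_nonneg k)) hK
  -- The index `0` stands for `φ₀`, not for `ψ_0`, so it goes to the extra point; the indices `k ≥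
  -- 1` are also indices of `|f|_K`, as `K ≥ 0`.
  let e : ℕ → Unit ⊕ {k : ℤ // ((-k : ℤ) : WithTop ℤ) ≤ K} := fun k =>
    if k = 0 then Sum.inl () else Sum.inr ⟨k, hidx k⟩
  have he : Function.Injective e := by
    intro k l hkl
    by_cases hk : k = 0 <;> by_cases hl : l = 0 <;> simp [e, hk, hl] at hkl ⊢
    simpa using congrArg Subtype.val hkl
  refine (ENNReal.rpow_le_rpow (lqNorm_le_of_injective he (b := Sum.elim
    (fun _ => absBlock φ₀ f x) fun k : {k : ℤ // ((-k : ℤ) : WithTop ℤ) ≤ K} =>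
      twoPow ((k.1 : ℝ) * s) * absBlock (psiDyadic φ₀ k.1) f x) fun k => ?_) hr.le).trans
    ((lqNorm_sumElim_rpow_le hr hrq _ _).trans ?_)
  · by_cases hk : k = 0
    · simp [e, hk, phiDyadic, twoPow_zero]
    · simp [e, hk, phiDyadic]
  · refine add_le_add ?_ le_rfl
    refine (lqNorm_rpow_le_tsum hr hrq _).trans_eq ?_
    rw [tsum_fintype, Finset.univ_unique, Finset.sum_singleton]

/-- Positive indices are absorbed into `tlmNorm`; the others are estimated one by one, which
discards their `ℓ^q` structure but suffices because of the decay of their weights or their finite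
number. -/
theorem blockNorm_rpow_le (h : IsTest φ₀) (hp : 0 < p) (hr : 0 < r) (hr1 : r ≤ 1) (hrp : r ≤ p)
    (hrq : ENNReal.ofReal r ≤ q) {K : WithTop ℤ} {S : Set ℕ}
    (hS : ∀ k : ℕ, ((k : ℤ) : WithTop ℤ) ≤ K → k ∈ S) (f : 𝓢'(E, ℂ)) :
    blockNorm φ₀ s u p q K f ^ r ≤ tlmNorm φ₀ s u p q f ^ r +
      ∑' k : S, (twoPow (-(k : ℕ) * s) *
        morreyNorm u p (absBlock (psiDyadic φ₀ (-((k : ℕ) : ℤ))) f)) ^ r := by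
  let low : S → E → ℝ≥0∞ := fun k x =>
    twoPow (-(k : ℕ) * s) * absBlock (psiDyadic φ₀ (-((k : ℕ) : ℤ))) f x
  have hlow (k : S) : Measurable (low k) :=
    (measurable_absBlock (h.psiDyadic _) f).const_mul _
  have h₁ : blockNorm φ₀ s u p q K f ^ r ≤ tlmNorm φ₀ s u p q f ^ r +
      morreyNorm u p (fun x => lqNorm q fun k => low k x) ^ r := by
    refine morreyNorm_add_rpow_le hp hr hr1 hrp
      (measurable_lqNorm q fun k => (measurable_absBlock (h.phiDyadic k) f).const_mul _)
      (measurable_lqNorm q hlow) fun x => Or.inl ?_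
    have hidx (k : {k : ℤ // ((-k : ℤ) : WithTop ℤ) ≤ K}) (hk : ¬ 0 < k.1) :
        (-k.1).toNat ∈ S := by
      refine hS _ ?_
      rw [Int.toNat_of_nonneg (by omega)]
      exact k.2
    -- The index `0` carries `ψ_0`, which does not occur in `tlmNorm`, so it counts as low
    -- frequency.
    let e : {k : ℤ // ((-k : ℤ) : WithTop ℤ) ≤ K} → ℕ ⊕ S := fun k =>
      if hk : 0 < k.1 then Sum.inl k.1.toNat else Sum.inr ⟨(-k.1).toNat, hidx k hk⟩
    have he : Function.Injective e := by
      rintro ⟨k, hk'⟩ ⟨l, hl'⟩ hkl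
      by_cases hk : 0 < k <;> by_cases hl : 0 < l <;>
        simp only [e, hk, hl, dif_pos, dif_neg, not_false_eq_true, Sum.inl.injEq, Sum.inr.injEq,
          Subtype.mk.injEq, reduceCtorEq] at hkl ⊢ <;> omega
    refine (ENNReal.rpow_le_rpow (lqNorm_le_of_injective he (b := Sum.elim
      (fun k : ℕ => twoPow ((k : ℝ) * s) * absBlock (phiDyadic φ₀ k) f x)
      fun k => low k x) fun k => ?_) hr.le).trans (lqNorm_sumElim_rpow_le hr hrq _ _)
    obtain ⟨k, hk'⟩ := k
    by_cases hk : 0 < k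
    · lift k to ℕ using hk.le
      have hk0 : k ≠ 0 := by omega
      simp [e, hk0, Nat.pos_of_ne_zero hk0, phiDyadic]
    · obtain ⟨m, rfl⟩ : ∃ m : ℕ, k = -(m : ℤ) := ⟨(-k).toNat, by omega⟩
      simp only [e, dif_neg hk, Sum.elim_inr, low]
      simp
  refine h₁.trans ?_
  gcongr
  refine (morreyNorm_rpow_le_tsum hp hr hrp hlow fun x => lqNorm_rpow_le_tsum hr hrq _).trans ?_
  refine ENNReal.tsum_le_tsum fun k => ?_
  rw [morreyNorm_const_mul hp (twoPow_ne_top _)]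

/-- The low-frequency blocks in `|f|_K` are controlled if the relevant weights are summable. -/
theorem exists_blockNorm_le {a b : ℝ} (ha : 1 ≤ a) (hab : a < b) (hb : b ≤ 2)
    (h : IsCutoff a b φ₀) (hp : 0 < p) (hq : 0 < q) (hr : 0 < r) (hr1 : r ≤ 1) (hrp : r ≤ p)
    (hrq : ENNReal.ofReal r ≤ q) {K : WithTop ℤ} {S : Set ℕ}
    (hS : ∀ k : ℕ, ((k : ℤ) : WithTop ℤ) ≤ K → k ∈ S)
    (hsum : ∑' k : S, twoPow ((k : ℕ) * ((sigma d p - s) * r)) ≠ ⊤) :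
    ∃ C : ℝ≥0∞, C ≠ ⊤ ∧ ∀ f : 𝓢'(E, ℂ),
      blockNorm φ₀ s u p q K f ≤ C * tlmNorm φ₀ s u p q f := by
  obtain ⟨C, hC, hlow⟩ := exists_morreyNorm_absBlock_psiDyadic_le ha hab hb h u hp
  have hCr : C ^ r ≠ ⊤ := ENNReal.rpow_ne_top_of_nonneg hr.le hC
  refine ⟨(1 + C ^ r * ∑' k : S, twoPow ((k : ℕ) * ((sigma d p - s) * r))) ^ (1 / r),
    ENNReal.rpow_ne_top_of_nonneg (by positivity)
      (ENNReal.add_ne_top.2 ⟨ENNReal.one_ne_top, ENNReal.mul_ne_top hCr hsum⟩), fun f => ?_⟩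
  refine le_mul_of_rpow_le hr ((blockNorm_rpow_le h.isTest hp hr hr1 hrp hrq hS f).trans ?_)
  rw [add_mul, one_mul, mul_assoc, ← ENNReal.tsum_mul_right, ← ENNReal.tsum_mul_left]
  gcongr with k
  calc (twoPow (-(k : ℕ) * s) *
        morreyNorm u p (absBlock (psiDyadic φ₀ (-((k : ℕ) : ℤ))) f)) ^ r
      ≤ (twoPow (-(k : ℕ) * s) * (C * twoPow ((k : ℕ) * sigma d p) *
          tlmNorm φ₀ s u p q f)) ^ r := by
        gcongr
        refine (hlow k f).trans ?_
        gcongr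
        exact morreyNorm_absBlock_le_tlmNorm hp hq f
    _ = (C * twoPow ((k : ℕ) * (sigma d p - s)) * tlmNorm φ₀ s u p q f) ^ r := by
        have : ((k : ℕ) : ℝ) * (sigma d p - s) = -(k : ℕ) * s + (k : ℕ) * sigma d p := by ring
        rw [this, twoPow_add]
        ring_nf
    _ = _ := by
        rw [ENNReal.mul_rpow_of_nonneg _ _ hr.le, ENNReal.mul_rpow_of_nonneg _ _ hr.le,
          twoPow_rpow _ hr.le, mul_assoc, mul_assoc]

theorem clubNorm_equivalent_tlmNorm {a b : ℝ} (ha : 1 ≤ a) (hab : a < b) (hb : b ≤ 2)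
    (h : IsCutoff a b φ₀) (hp : 0 < p) (hq : 0 < q) {K : WithTop ℤ} (hK : 0 ≤ K)
    (hs : K = ⊤ → sigma d p < s) :
    Equivalent (clubNorm φ₀ s u p q K) (tlmNorm φ₀ s u p q) := by
  obtain ⟨r, hr, hr1, hrp, hrq⟩ := exists_common_exponent hp hq
  obtain ⟨C, hC, hblock⟩ : ∃ C : ℝ≥0∞, C ≠ ⊤ ∧ ∀ f : 𝓢'(E, ℂ),
      blockNorm φ₀ s u p q K f ≤ C * tlmNorm φ₀ s u p q f := by
    refine exists_blockNorm_le ha hab hb h hp hq hr hr1 hrp hrq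
      (S := {k : ℕ | ((k : ℤ) : WithTop ℤ) ≤ K}) (fun k hk => hk) ?_
    -- For `K = ∞` the weights form a geometric series with ratio below `1`, by `s > σ_p`; for
    -- finite `K` the sum is finite.
    induction K using WithTop.recTopCoe with
    | top =>
      refine ne_top_of_le_ne_top (tsum_twoPow_ne_top (t := (sigma d p - s) * r) ?_)
        (ENNReal.tsum_comp_le_tsum_of_injective Subtype.val_injective _)
      exact mul_neg_of_neg_of_pos (by linarith [hs rfl]) hr
    | coe K =>
      have : Finite {k : ℕ | ((k : ℤ) : WithTop ℤ) ≤ (K : WithTop ℤ)} := by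
        refine (Set.finite_Iic K.toNat).subset fun k hk => ?_
        have hk' : (k : ℤ) ≤ K := WithTop.coe_le_coe.1 hk
        simp only [Set.mem_Iic]
        omega
      have := Fintype.ofFinite {k : ℕ | ((k : ℤ) : WithTop ℤ) ≤ (K : WithTop ℤ)}
      rw [tsum_fintype]
      exact ENNReal.sum_ne_top.2 fun k _ => twoPow_ne_top _
  -- The factor `2^{1/r}` comes from `x^r + y^r ≤ 2 (x + y)^r`.
  refine .of_le (A := 1 + C) (B := 2 ^ (1 / r))
    (ENNReal.add_ne_top.2 ⟨ENNReal.one_ne_top, hC⟩)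
    (ENNReal.rpow_ne_top_of_nonneg (by positivity) ENNReal.ofNat_ne_top) (fun f => ?_) fun f => ?_
  · rw [add_mul, one_mul]
    exact add_le_add (morreyNorm_absBlock_le_tlmNorm hp hq f) (hblock f)
  · refine le_mul_of_rpow_le hr ((tlmNorm_rpow_le h.isTest hp hr hr1 hrp hrq hK f).trans ?_)
    rw [two_mul]
    gcongr
    · exact le_self_add
    · exact le_add_self

/-- The low-frequency part is recovered from a lower-frequency part and finitely many blocks. -/
theorem morreyNorm_absBlock_rpow_le (h : IsTest φ₀) (hp : 0 < p) (hr : 0 < r) (hr1 : r ≤ 1)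
    (hrp : r ≤ p) (f : 𝓢'(E, ℂ)) (K : ℕ) :
    morreyNorm u p (absBlock φ₀ f) ^ r ≤
      morreyNorm u p (absBlock (dilate ((2 : ℝ) ^ K) φ₀) f) ^ r +
        ∑ k ∈ Finset.range K, morreyNorm u p (absBlock (psiDyadic φ₀ (-(k : ℤ))) f) ^ r := by
  induction K with
  | zero =>
    have : dilate ((2 : ℝ) ^ 0) φ₀ = φ₀ := by funext x; simp [dilate]
    rw [this]
    simp
  | succ K ih =>
    -- One more telescoping step: `D_{2^K} φ₀ = D_{2^{K+1}} φ₀ + ψ_{-K}`.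
    refine ih.trans ?_
    rw [Finset.sum_range_succ, add_comm (∑ k ∈ _, _), ← add_assoc]
    gcongr
    have hdil (m : ℕ) : IsTest (dilate ((2 : ℝ) ^ m) φ₀) := h.dilate (by positivity)
    refine morreyNorm_add_rpow_le hp hr hr1 hrp (measurable_absBlock (hdil _) f)
      (measurable_absBlock (h.psiDyadic _) f) fun x => Or.inr ?_
    refine absBlock_le_add (hdil _) (hdil _) (h.psiDyadic _) (fun x => ?_) f x
    rw [psiDyadic_neg_natCast_apply, add_sub_cancel]

theorem clubNorm_equivalent_dilatedNorm {a b : ℝ} (ha : 1 ≤ a) (hab : a < b) (hb : b ≤ 2)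
    (h : IsCutoff a b φ₀) (hp : 0 < p) (hq : 0 < q) (K : ℕ) :
    Equivalent (clubNorm φ₀ s u p q ((K : ℤ) : WithTop ℤ)) (dilatedNorm φ₀ s u p q K) := by
  have hr : 0 < min 1 p := lt_min one_pos hp
  have ht : (2 : ℝ) ≤ 2 ^ (K + 1) := by
    simpa using pow_le_pow_right₀ (one_le_two (α := ℝ)) (Nat.le_add_left 1 K)
  obtain ⟨C, hC, hdil⟩ := exists_morreyNorm_absBlock_dilate_le ha hab hb h u hp ht
  set r := min 1 p with hrdef
  have hmul (t : ℝ) (x : ℝ≥0∞) : x = twoPow t * (twoPow (-t) * x) := by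
    rw [← mul_assoc, ← twoPow_add, add_neg_cancel, twoPow_zero, one_mul]
  -- These factors undo the weights in `dilatedNorm`: `2^{-Ks}` on the block of `D_{2^{K+1}} φ₀`,
  -- and `2^{-ks}` on `ψ_{-k}` for `k ≤ K`.
  set D : ℝ≥0∞ := twoPow (K * s) ^ r + ∑ k ∈ Finset.range (K + 1), twoPow (k * s) ^ r with hDdef
  have hpow (t : ℝ) : twoPow t ^ r ≠ ⊤ := ENNReal.rpow_ne_top_of_nonneg hr.le (twoPow_ne_top t)
  have hD : D ≠ ⊤ := ENNReal.add_ne_top.2 ⟨hpow _, ENNReal.sum_ne_top.2 fun k _ => hpow _⟩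
  have hD' : D ^ (1 / r) ≠ ⊤ := ENNReal.rpow_ne_top_of_nonneg (by positivity) hD
  refine .of_le (A := D ^ (1 / r) + 1) (B := twoPow (-(K : ℝ) * s) * C + 1)
    (ENNReal.add_ne_top.2 ⟨hD', ENNReal.one_ne_top⟩)
    (ENNReal.add_ne_top.2 ⟨ENNReal.mul_ne_top (twoPow_ne_top _) hC, ENNReal.one_ne_top⟩)
    (fun f => ?_) fun f => ?_
  · rw [add_mul, one_mul]
    refine add_le_add (le_mul_of_rpow_le hr ?_) le_add_self
    refine (morreyNorm_absBlock_rpow_le h.isTest hp hr (min_le_left _ _) (min_le_right _ _) f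
      (K + 1)).trans ?_
    rw [hDdef, add_mul, Finset.sum_mul]
    gcongr with k hk
    · rw [← ENNReal.mul_rpow_of_nonneg _ _ hr.le]
      gcongr
      rw [hmul (K * s) (morreyNorm u p _)]
      gcongr
      rw [← neg_mul]
      exact le_self_add
    · rw [← ENNReal.mul_rpow_of_nonneg _ _ hr.le]
      gcongr
      rw [hmul (k * s) (morreyNorm u p _)]
      gcongr
      have hk' : ((-(-(k : ℤ)) : ℤ) : WithTop ℤ) ≤ ((K : ℤ) : WithTop ℤ) := by
        rw [neg_neg, WithTop.coe_le_coe]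
        have := Finset.mem_range.1 hk
        omega
      have := mul_morreyNorm_absBlock_le_blockNorm (φ₀ := φ₀) (s := s) (u := u) hp hq hk' f
      rw [Int.cast_neg, Int.cast_natCast, neg_mul] at this
      exact this.trans le_add_self
  · rw [add_mul, one_mul, mul_assoc]
    refine add_le_add ?_ le_add_self
    gcongr
    exact (hdil f).trans (by gcongr; exact le_self_add)

end Norms

end TLM

theorem mainTheorem4 (d : ℕ) (hd : 0 < d) (a b : ℝ) (ha : 1 ≤ a) (hab : a < b) (hb : b ≤ 2)
    (φ₀ : EuclideanSpace ℝ (Fin d) → ℝ) (hφ₀ : TLM.IsCutoff a b φ₀)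
    (s u p : ℝ) (hp : 0 < p) (hpu : p ≤ u) (q : ℝ≥0∞) (hq : 0 < q) :
    (∀ K : ℕ,
      TLM.Equivalent (TLM.tlmNorm φ₀ s u p q)
        (TLM.clubNorm φ₀ s u p q ((K : ℤ) : WithTop ℤ)) ∧
      TLM.Equivalent (TLM.tlmNorm φ₀ s u p q) (TLM.dilatedNorm φ₀ s u p q K) ∧
      TLM.Equivalent (TLM.clubNorm φ₀ s u p q ((K : ℤ) : WithTop ℤ))
        (TLM.dilatedNorm φ₀ s u p q K)) ∧
    (TLM.sigma d p < s →
      TLM.Equivalent (TLM.clubNorm φ₀ s u p q ⊤) (TLM.tlmNorm φ₀ s u p q)) := by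
  refine ⟨fun K => ?_, fun hs => TLM.clubNorm_equivalent_tlmNorm ha hab hb hφ₀ hp hq le_top
    fun _ => hs⟩
  have h₁ : TLM.Equivalent (TLM.clubNorm φ₀ s u p q ((K : ℤ) : WithTop ℤ))
      (TLM.tlmNorm φ₀ s u p q) :=
    TLM.clubNorm_equivalent_tlmNorm ha hab hb hφ₀ hp hq
      (by exact_mod_cast Int.natCast_nonneg K) fun h => absurd h WithTop.coe_ne_top
  have h₂ := TLM.clubNorm_equivalent_dilatedNorm (s := s) (u := u) ha hab hb hφ₀ hp hq K
  exact ⟨h₁.symm, h₁.symm.trans h₂, h₂⟩
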